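/- Let either (a) $\mathcal A$ be a unital $C^*$-algebra, $F=\mathcal A^*$ its dual, and $(T_t)_{t\ge 0}$ a $C_0$-semigroup on $\mathcal A$, i.e. a family of bounded linear operators with $T_tT_s=T_{t+s}$, $T_0=\mathrm{id}$ and $\lim_{t\downarrow 0}\|T_t(x)-x\|=0$ for all $x\in\mathcal A$; or (b) $\mathcal A$ be a von Neumann algebra on a Hilbert space, $F=\mathcal A_*$ its predual (the $\sigma$-weakly continuous functionals), and $(T_t)_{t\ge 0}$ a $C_0^*$-semigroup on $\mathcal A$, i.e. a family of bounded linear operators with $T_tT_s=T_{t+s}$, $T_0=\mathrm{id}$ such that $t\mapsto\eta(T_t(x))$ is continuous for all $x\in\mathcal A$, $\eta\in F$, and $x\mapsto\eta(T_t(x))$ is $\sigma(\mathcal A,F)$-continuous for all $\eta\in F$, $t\ge 0$. Here $\sigma(\mathcal A,F)$ is the coarsest topology on $\mathcal A$ for which all functionals in $F$ are continuous. Assume that every $T_t$ is symmetric, $T_t(x^*)=T_t(x)^*$ for all $x\in\mathcal A$. Let $L$ be the generator: $x\in D(L)$ and $L(x)=y$ if and only if $\frac1t(T_t(x)-x)\to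 y$ in $\sigma(\mathcal A,F)$ as $t\downarrow 0$. Then $\lambda-L:D(L)\to\mathcal A$ has a bounded inverse $(\lambda-L)^{-1}$ for all sufficiently large $\lambda>0$, and the following conditions are equivalent, where "for all large $\lambda$" means that there is $\lambda_0>0$ such that the condition holds (for all $a$, respectively $u$) for every $\lambda\ge\lambda_0$: 1. $T_t$ is positive (it maps positive elements to positive elements) for all $t\ge 0$. 2. $(\lambda-L)^{-1}$ is positive for all large $\lambda$. 3. $(\lambda-L)^{-1}(a^2)+a(\lambda-L)^{-1}(\mathbf 1)a\ge(\lambda-L)^{-1}(a)a+a(\lambda-L)^{-1}(a)$ for all self-adjoint $a\in\mathcal A$ and all large $\lambda$. 4. $(\lambda-L)^{-1}(\mathbf 1)+u^*(\lambda-L)^{-1}(\mathbf 1)u\ge(\lambda-L)^{-1}(u^*)u+u^*(\lambda-L)^{-1}(u)$ for all unitary $u\in\mathcal A$ and all large $\lambda$. 5. $T_t(a^2)+aT_t(\mathbf 1)a\ge T_t(a)a+aT_t(a)$ for all self-adjoint $a\in\mathcal A$ and all $t\ge 0$. 6. $T_t(\mathbf 1)+u^*T_t(\mathbf 1)u\ge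 T_t(u^*)u+u^*T_t(u)$ for all unitary $u\in\mathcal A$ and all $t\ge 0$. -/

import Mathlib

open Filter Topology
open scoped NNReal InnerProductSpace

section Semigroups

variable {A : Type*} [NormedRing A] [NormedAlgebra ℂ A]

/-- The locally convex topology `σ(A, F)` on `A`: the coarsest topology for which every
functional of the set `F` is continuous. -/
noncomputable abbrev sigmaTopology (F : Set (StrongDual ℂ A)) : TopologicalSpace A :=
  ⨅ η ∈ F, TopologicalSpace.induced (fun x : A => η x) inferInstance

/-- A one-parameter semigroup of bounded linear operators, without any continuity in `t`. -/
structure IsOperatorSemigroup (T : ℝ≥0 → A →L[ℂ] A) : Prop where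
  map_add : ∀ t s : ℝ≥0, T t ∘L T s = T (t + s)
  map_zero : T 0 = ContinuousLinearMap.id ℂ A

/-- A strongly continuous (`C₀`-) semigroup. -/
structure IsC0Semigroup (T : ℝ≥0 → A →L[ℂ] A) : Prop extends IsOperatorSemigroup T where
  tendsto_zero : ∀ x : A, Tendsto (fun t : ℝ≥0 => ‖T t x - x‖) (𝓝[>] 0) (𝓝 0)

/-- A `C₀^*`-semigroup, where `F` is the predual, seen as a set of functionals. -/
structure IsC0StarSemigroup (F : Set (StrongDual ℂ A)) (T : ℝ≥0 → A →L[ℂ] A) : Prop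
    extends IsOperatorSemigroup T where
  continuous_time : ∀ x : A, ∀ η ∈ F, Continuous fun t : ℝ≥0 => η (T t x)
  continuous_space : ∀ η ∈ F, ∀ t : ℝ≥0,
    Continuous[sigmaTopology F, inferInstance] fun x : A => η (T t x)

/-- `L` is the generator of `T` with respect to `σ(A, F)`: `x ∈ D(L)` and `L x = y` if and only
if `t⁻¹ (T_t x - x)` tends to `y` in `σ(A, F)` as `t ↓ 0`. -/
def IsGenerator (F : Set (StrongDual ℂ A)) (T : ℝ≥0 → A →L[ℂ] A) (L : A →ₗ.[ℂ] A) : Prop :=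
  ∀ x y : A, (x, y) ∈ L.graph ↔
    Tendsto (fun t : ℝ≥0 => ((t : ℝ) : ℂ)⁻¹ • (T t x - x)) (𝓝[>] 0)
      (@nhds A (sigmaTopology F) y)

/-- `R` is the resolvent `(lam - L)⁻¹`, i.e. a bounded two-sided inverse of
`lam - L : D(L) → A`. -/
def IsResolvent (L : A →ₗ.[ℂ] A) (lam : ℝ) (R : A →L[ℂ] A) : Prop :=
  (∀ x : A, ∃ h : R x ∈ L.domain, (lam : ℂ) • R x - L ⟨R x, h⟩ = x) ∧
    ∀ x : L.domain, R ((lam : ℂ) • (x : A) - L x) = x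

/-- A symmetric (star-preserving) operator. -/
def IsSymmetricMap [Star A] (S : A →L[ℂ] A) : Prop := ∀ x : A, S (star x) = star (S x)

/-- A positive operator: it leaves the positive cone invariant. -/
def IsPositiveMap [PartialOrder A] (S : A →L[ℂ] A) : Prop := ∀ a : A, 0 ≤ a → 0 ≤ S a

/-- `S(a²) + a S(1) a ≥ S(a) a + a S(a)` for all self-adjoint `a`. -/
def SelfAdjointInequality [Star A] [PartialOrder A] (S : A →L[ℂ] A) : Prop :=
  ∀ a : A, IsSelfAdjoint a → S a * a + a * S a ≤ S (a ^ 2) + a * S 1 * a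

/-- `S(1) + u^* S(1) u ≥ S(u^*) u + u^* S(u)` for all unitary `u`. -/
def UnitaryInequality [StarRing A] [PartialOrder A] (S : A →L[ℂ] A) : Prop :=
  ∀ u ∈ unitary A, S (star u) * u + star u * S u ≤ S 1 + star u * S 1 * u

end Semigroups

/-- The predual of a von Neumann algebra `M` on `H`: the `σ`-weakly continuous functionals
`x ↦ ∑ ⟪ξ n, x (ζ n)⟫` with `∑ ‖ξ n‖² < ∞` and `∑ ‖ζ n‖² < ∞`. -/
def VonNeumannAlgebra.predual {H : Type*} [NormedAddCommGroup H] [InnerProductSpace ℂ H]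
    [CompleteSpace H] (M : VonNeumannAlgebra H) : Set (StrongDual ℂ M.toStarSubalgebra) :=
  {η | ∃ ξ ζ : ℕ → H, (Summable fun n => ‖ξ n‖ ^ 2) ∧ (Summable fun n => ‖ζ n‖ ^ 2) ∧
    ∀ x : M.toStarSubalgebra, HasSum (fun n => ⟪ξ n, (x : H →L[ℂ] H) (ζ n)⟫_ℂ) (η x)}

/-!
Both kinds of semigroup are treated at once, tested against the functionals `η ∈ F`
(`IsWeakSemigroup`): an exponential bound, weak continuity, and the existence in `A` of the weak
Laplace transforms `R lam = ∫ e^{-lam t} T_t dt`. These transforms are the resolvents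
`(lam - L)⁻¹` (`IsWeakSemigroup.isResolvent_laplace`). The conditions are then linked as follows.

* A positive operator satisfies both quadratic inequalities
  (`IsPositiveMap.le_of_isStarNormal`): for `a` normal with finite spectrum and spectral
  projections `pᵢ`, the difference of the two sides is `∑ (wᵢ - a)* S(pᵢ) (wᵢ - a)`, and partitions
  of unity on the spectrum replace the projections in general.
* The unitary inequality for an operator implies the self-adjoint one, by a second-order expansion
  along `u = exp(isa)` (`UnitaryInequality.selfAdjointInequality`).
* Both inequalities are linear in the operator, so they pass from the semigroup to its Laplace
  transforms (`IsWeakSemigroup.laplace_le_of_forall_le`).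
* If all the resolvents satisfy the self-adjoint inequality, they are positive
  (`isPositiveMap_of_forall_selfAdjointInequality`). For a bounded operator `S` with this inequality,
  `(κ - S)⁻¹` is positive for large `κ`, by an argument at the bottom of the spectrum
  (`SelfAdjointInequality.nonneg_of_smul_sub`), and Neumann series propagate this to all `κ` down to
  the first singularity. For `S = (lam - L)⁻¹` and `κ = (lam - μ)⁻¹` the inverse is a positive
  multiple of `(lam - μ)⁻¹ + (μ - L)⁻¹`, which tends to `(μ - L)⁻¹` as `lam → ∞`.
* If the resolvents near infinity are positive, so are their powers, that is, the integrals
  `∫ r^k e^{-lam r} η(T_r x) dr` are nonnegative for `η, x ≥ 0`. As the weights concentrate at a point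
  for suitable `lam` and `k → ∞`, `T_t x ≥ 0`
  (`nonneg_of_forall_integral_pow_mul_exp_nonneg`, `IsWeakSemigroup.isPositiveMap_of_laplace`).
-/

/-! ### The quadratic inequalities for a positive operator -/

section SingleOperator

variable {A : Type*} [CStarAlgebra A] [PartialOrder A] [StarOrderedRing A]

/-- A compact metric space carries partitions of unity of arbitrarily small mesh. -/
theorem exists_partition_of_unity_dist_lt (X : Type*) [MetricSpace X] [CompactSpace X] {ε : ℝ}
    (hε : 0 < ε) : ∃ (n : ℕ) (w : Fin n → X) (f : Fin n → C(X, ℝ)),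
      (∀ i x, 0 ≤ f i x) ∧ (∀ x, ∑ i, f i x = 1) ∧ ∀ i x, f i x ≠ 0 → dist x (w i) < ε := by
  obtain ⟨t, -, htf, ht⟩ := (isCompact_univ (X := X)).finite_cover_balls hε
  let e := htf.toFinset.equivFin
  let w : Fin htf.toFinset.card → X := fun i => (e.symm i : X)
  have hcov : (Set.univ : Set X) ⊆ ⋃ i, Metric.ball (w i) ε := by
    intro x hx
    obtain ⟨y, hy, hxy⟩ := Set.mem_iUnion₂.1 (ht hx)
    refine Set.mem_iUnion.2 ⟨e ⟨y, htf.mem_toFinset.2 hy⟩, ?_⟩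
    simpa [w] using hxy
  obtain ⟨f, hfs, hf1, hf01, -⟩ := exists_continuous_sum_one_of_isOpen_isCompact
    (fun i => Metric.isOpen_ball (x := w i) (ε := ε)) isCompact_univ hcov
  refine ⟨_, w, f, fun i x => (hf01 i x).1, fun x => ?_, fun i x hx => ?_⟩
  · simpa using hf1 (Set.mem_univ x)
  · exact hfs i (subset_tsupport _ hx)

/-- The Kadison-type inequality for a positive map `S` and a normal element `a`: approximating the
identity function on the spectrum of `a` by `∑ wᵢ fᵢ` for a fine partition of unity `f`, the
difference of the two sides is a limit of the sums `∑ (wᵢ - a)* S(fᵢ(a)) (wᵢ - a)`. -/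
theorem IsPositiveMap.le_of_isStarNormal {S : A →L[ℂ] A} (hS : IsPositiveMap S) (a : A)
    (ha : IsStarNormal a) :
    S (star a) * a + star a * S a ≤ S (star a * a) + star a * S 1 * a := by
  let X := spectrum ℂ a
  let φ : C(X, ℂ) →⋆ₐ[ℂ] A := cfcHom ha
  let z : C(X, ℂ) := (ContinuousMap.id ℂ).restrict X
  have hz : φ z = a := cfcHom_id ha
  have hφ : Continuous φ := cfcHom_continuous ha
  let G : C(X, ℂ) × C(X, ℂ) → A := fun p =>
    S (φ p.1) + star a * S 1 * a - S (φ (star p.2)) * a - star a * S (φ p.2)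
  have hG : Continuous G := by
    have h1 : Continuous fun p : C(X, ℂ) × C(X, ℂ) => S (φ p.1) :=
      S.continuous.comp (hφ.comp continuous_fst)
    have h2 : Continuous fun p : C(X, ℂ) × C(X, ℂ) => S (φ (star p.2)) :=
      S.continuous.comp (hφ.comp (continuous_star.comp continuous_snd))
    have h3 : Continuous fun p : C(X, ℂ) × C(X, ℂ) => S (φ p.2) :=
      S.continuous.comp (hφ.comp continuous_snd)
    exact ((h1.add continuous_const).sub (h2.mul continuous_const)).sub (continuous_const.mul h3)
  have hclosed : IsClosed {p | 0 ≤ G p} := isClosed_le continuous_const hG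
  have hmem : (star z * z, z) ∈ closure {p | 0 ≤ G p} := by
    rw [Metric.mem_closure_iff]
    intro ε hε
    set C : ℝ := ‖z‖ with hC
    have hC0 : 0 ≤ C := norm_nonneg _
    have hzC : ∀ x : X, ‖(x : ℂ)‖ ≤ C := fun x => z.norm_coe_le_norm x
    set δ : ℝ := ε / (4 * (C + 1)) with hδ
    have hδ0 : 0 < δ := by positivity
    obtain ⟨n, w, f, hf0, hf1, hfd⟩ := exists_partition_of_unity_dist_lt X hδ0
    let g : Fin n → C(X, ℂ) := fun i => (ContinuousMap.mk _ Complex.continuous_ofReal).comp (f i)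
    have hg0 : ∀ i, 0 ≤ φ (g i) := by
      intro i
      let r : C(X, ℂ) := (ContinuousMap.mk _ Complex.continuous_ofReal).comp
        ((ContinuousMap.mk _ Real.continuous_sqrt).comp (f i))
      have : g i = star r * r := by
        ext x
        simp [g, r, ← Complex.ofReal_mul, Real.mul_self_sqrt (hf0 i x)]
      rw [this, map_mul, map_star]
      exact star_mul_self_nonneg _
    have hg1 : ∑ i, g i = 1 := by
      ext x
      simp [g, ← Complex.ofReal_sum, hf1]
    let P1 : C(X, ℂ) := ∑ i, (w i : ℂ) • g i
    let P2 : C(X, ℂ) := ∑ i, (star (w i : ℂ) * (w i : ℂ)) • g i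
    -- The approximation of a function `h` by `∑ h(wᵢ) fᵢ`; it is used for `h y = y` and for
    -- `h y = |y|²`.
    have key : ∀ (h : ℂ → ℂ) (η : ℝ) (x : X), (∀ i, f i x ≠ 0 → ‖h x - h (w i)‖ ≤ η) →
        ‖h x - ∑ i, h (w i) * (f i x : ℂ)‖ ≤ η := by
      intro h η x hh
      have : h x - ∑ i, h (w i) * (f i x : ℂ) = ∑ i, (h x - h (w i)) * (f i x : ℂ) := by
        simp_rw [sub_mul, Finset.sum_sub_distrib, ← Finset.mul_sum, ← Complex.ofReal_sum, hf1]
        simp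
      rw [this]
      calc _ ≤ ∑ i, η * f i x := by
            refine norm_sum_le_of_le _ fun i _ => ?_
            rw [norm_mul, Complex.norm_real, Real.norm_of_nonneg (hf0 i x)]
            rcases eq_or_ne (f i x) 0 with h0 | h0
            · simp [h0]
            · exact mul_le_mul_of_nonneg_right (hh i h0) (hf0 i x)
        _ = η := by rw [← Finset.mul_sum, hf1, mul_one]
    have hδε : δ < ε := by
      rw [hδ, div_lt_iff₀ (by positivity)]
      nlinarith
    have hδε2 : 2 * C * δ < ε := by
      have : ε = δ * (4 * (C + 1)) := by rw [hδ]; field_simp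
      nlinarith
    refine ⟨(P2, P1), ?_, ?_⟩
    · have hsum : G (P2, P1) = ∑ i, star ((w i : ℂ) • (1 : A) - a) * S (φ (g i)) *
          ((w i : ℂ) • (1 : A) - a) := by
        have h1 : S 1 = ∑ i, S (φ (g i)) := by
          rw [← map_sum, ← map_sum, hg1, map_one φ]
        simp only [G, P1, P2, h1, map_sum, star_sum, map_smul, Finset.sum_mul, Finset.mul_sum,
          star_smul, map_star, (IsSelfAdjoint.of_nonneg (hg0 _)).star_eq]
        rw [← Finset.sum_add_distrib, ← Finset.sum_sub_distrib, ← Finset.sum_sub_distrib]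
        refine Finset.sum_congr rfl fun i _ => ?_
        simp only [star_sub, star_smul, star_one, sub_mul, mul_sub, smul_mul_assoc, one_mul,
          mul_smul_comm, mul_one, smul_sub, smul_smul]
        rw [mul_comm (w i : ℂ)]
        abel
      change 0 ≤ G (P2, P1)
      rw [hsum]
      exact Finset.sum_nonneg fun i _ => star_left_conjugate_nonneg (hS _ (hg0 i)) _
    · rw [Prod.dist_eq, max_lt_iff, dist_eq_norm, dist_eq_norm]
      constructor
      · refine lt_of_le_of_lt ((ContinuousMap.norm_le _ (by positivity)).2 fun x => ?_) hδε2
        have := key (fun y => star y * y) (2 * C * δ) x (fun i hi => ?_)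
        · simpa [P2, g, z] using this
        · have hd : ‖(x : ℂ) - w i‖ ≤ δ := by
            have := (hfd i x hi).le
            rwa [Subtype.dist_eq, dist_eq_norm] at this
          have : star (x : ℂ) * x - star (w i : ℂ) * w i =
              star ((x : ℂ) - w i) * x + star (w i : ℂ) * (x - w i) := by
            rw [star_sub]; ring
          rw [this]
          refine (norm_add_le _ _).trans ?_
          rw [norm_mul, norm_mul, norm_star, norm_star]
          have h1 := mul_le_mul hd (hzC x) (norm_nonneg _) hδ0.le
          have h2 := mul_le_mul (hzC (w i)) hd (norm_nonneg _) hC0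
          linarith
      · refine lt_of_le_of_lt ((ContinuousMap.norm_le _ hδ0.le).2 fun x => ?_) hδε
        have := key (fun y => y) δ x (fun i hi => ?_)
        · simpa [P1, g, z] using this
        · have := (hfd i x hi).le
          rwa [Subtype.dist_eq, dist_eq_norm] at this
  have h := hclosed.closure_subset hmem
  have h' : 0 ≤ S (star a * a) + star a * S 1 * a - S (star a) * a - star a * S a := by
    simpa [G, hz, map_mul, map_star] using h
  rw [← sub_nonneg]
  convert h' using 1
  abel

theorem IsPositiveMap.selfAdjointInequality {S : A →L[ℂ] A} (hS : IsPositiveMap S) :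
    SelfAdjointInequality S := by
  intro a ha
  simpa [ha.star_eq, sq] using hS.le_of_isStarNormal a ha.isStarNormal

theorem IsPositiveMap.unitaryInequality {S : A →L[ℂ] A} (hS : IsPositiveMap S) :
    UnitaryInequality S := by
  intro u hu
  have hn : IsStarNormal u := ⟨by
    rw [Commute, SemiconjBy, Unitary.star_mul_self_of_mem hu, Unitary.mul_star_self_of_mem hu]⟩
  simpa [Unitary.star_mul_self_of_mem hu] using hS.le_of_isStarNormal u hn

end SingleOperator

/-! ### Positivity of the resolvent of a bounded operator -/

section BoundedResolvent

theorem inverse_smul_sub_eq_tsum_mul {E : Type*} [NormedRing E] [NormedAlgebra ℂ E]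
    [CompleteSpace E] {S : E} {κ ε : ℝ} (hu : IsUnit ((κ : ℂ) • (1 : E) - S))
    (hn : ‖(ε : ℂ) • Ring.inverse ((κ : ℂ) • (1 : E) - S)‖ < 1) :
    Ring.inverse (((κ - ε : ℝ) : ℂ) • (1 : E) - S) =
      (∑' n : ℕ, ((ε : ℂ) • Ring.inverse ((κ : ℂ) • (1 : E) - S)) ^ n) *
        Ring.inverse ((κ : ℂ) • (1 : E) - S) := by
  set P := Ring.inverse ((κ : ℂ) • (1 : E) - S) with hPdef
  obtain ⟨v, hv⟩ := hu
  have hPv : P = ↑v⁻¹ := by rw [hPdef, ← hv, Ring.inverse_unit]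
  have hfac : (((κ - ε : ℝ) : ℂ) • (1 : E) - S) = ↑(v * Units.oneSub ((ε : ℂ) • P) hn) := by
    rw [Units.val_mul, Units.val_oneSub, mul_sub, mul_one, mul_smul_comm, hPv, Units.mul_inv, hv,
      Complex.ofReal_sub, sub_smul]
    abel
  rw [hfac, Ring.inverse_unit, mul_inv_rev, Units.val_mul, ← hPv]
  rfl

variable {A : Type*} [CStarAlgebra A] [PartialOrder A] [StarOrderedRing A]

/-- The second-order term of the unitary inequality along `u = exp(isa)` is the self-adjoint
inequality at `a`. In terms of `v = u - 1`, unitarity reads `v* + v = -v* v`, which makes the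
difference of the two sides of the unitary inequality quadratic in `v`. -/
theorem UnitaryInequality.selfAdjointInequality {S : A →L[ℂ] A} (hS : UnitaryInequality S) :
    SelfAdjointInequality S := by
  intro a ha
  let Q : A → A := fun v => S (star v * v) + star v * S 1 * v - S (star v) * v - star v * S v
  have hQ : Continuous Q := by fun_prop
  let u : ℝ → A := fun s => NormedSpace.exp (s • (Complex.I • a))
  have hu : ∀ s, u s ∈ unitary A := fun s => by
    have := (selfAdjoint.expUnitary (s • (⟨a, ha⟩ : selfAdjoint A))).2
    rwa [selfAdjoint.expUnitary_coe, selfAdjoint.val_smul, smul_comm] at this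
  have hQu : ∀ s, 0 ≤ Q (u s - 1) := fun s => by
    have h1 : star (u s) * u s = 1 := Unitary.star_mul_self_of_mem (hu s)
    have h2 : Q (u s - 1) = S 1 + star (u s) * S 1 * u s - (S (star (u s)) * u s +
        star (u s) * S (u s)) := by
      simp only [Q, star_sub, star_one, sub_mul, mul_sub, mul_one, one_mul, h1, map_sub]
      abel
    rw [h2]
    exact sub_nonneg.2 (hS _ (hu s))
  have hder : HasDerivAt u (Complex.I • a) 0 := by
    simpa [u] using hasDerivAt_exp_smul_const (𝕂 := ℝ) (Complex.I • a) (0 : ℝ)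
  have hlim : Tendsto (fun s : ℝ => s⁻¹ • (u s - 1)) (𝓝[≠] 0) (𝓝 (Complex.I • a)) := by
    have := hder.tendsto_slope_zero
    simpa [u] using this
  have hpos : ∀ s : ℝ, 0 ≤ Q (s⁻¹ • (u s - 1)) := fun s => by
    have : Q (s⁻¹ • (u s - 1)) = (s⁻¹ * s⁻¹) • Q (u s - 1) := by
      have hS' : ∀ (c : ℝ) (x : A), S (c • x) = c • S x := fun c x => by
        rw [← Complex.coe_smul, map_smul, Complex.coe_smul]
      generalize u s - 1 = v
      simp only [Q, star_smul, star_trivial, smul_mul_assoc, mul_smul_comm, hS', smul_smul,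
        smul_add, smul_sub]
    rw [this]
    exact smul_nonneg (mul_self_nonneg _) (hQu s)
  have h := ge_of_tendsto' ((hQ.tendsto _).comp hlim) hpos
  rw [← sub_nonneg]
  convert h using 1
  simp only [Q, star_smul, ha.star_eq, smul_mul_assoc, mul_smul_comm, map_smul, smul_smul, sq]
  simp
  abel

/-- A noninvertible positive element has approximate null vectors in the algebra it generates. -/
theorem exists_one_le_norm_norm_mul_le {a : A} (ha : 0 ≤ a) (hu : ¬ IsUnit a) {ε : ℝ}
    (hε : 0 < ε) : ∃ e : A, IsSelfAdjoint e ∧ 1 ≤ ‖e‖ ∧ ‖a * e‖ ≤ ε := by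
  have hsa : IsSelfAdjoint a := ha.isSelfAdjoint
  have h0 : (0 : ℝ) ∈ spectrum ℝ a := by
    rw [spectrum.zero_mem_iff]; exact hu
  have hnn : ∀ x ∈ spectrum ℝ a, 0 ≤ x := fun x hx => spectrum_nonneg_of_nonneg ha hx
  have hc : ContinuousOn (fun x : ℝ => ε / (ε + x)) (spectrum ℝ a) :=
    continuousOn_const.div (by fun_prop) fun x hx => by have := hnn x hx; positivity
  -- `ε / (ε + x)` equals `1` at the spectral value `0`, while `x ε / (ε + x) ≤ ε`.
  refine ⟨cfc (fun x : ℝ => ε / (ε + x)) a, cfc_predicate _ a, ?_, ?_⟩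
  · have : ‖ε / (ε + 0)‖ ≤ _ := norm_apply_le_norm_cfc (fun x : ℝ => ε / (ε + x)) a h0 hc
    simpa [hε.ne'] using this
  · have : a * cfc (fun x : ℝ => ε / (ε + x)) a = cfc (fun x : ℝ => x * (ε / (ε + x))) a := by
      rw [cfc_mul (fun x : ℝ => x) (fun x : ℝ => ε / (ε + x)) a (by fun_prop) hc, cfc_id' ℝ a]
    rw [this]
    refine norm_cfc_le hε.le fun x hx => ?_
    have := hnn x hx
    rw [Real.norm_of_nonneg (by positivity), mul_div_assoc', div_le_iff₀ (by positivity)]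
    nlinarith

/-- A self-adjoint `y` whose image under `κ - S` is positive is itself positive, for `κ > ‖S 1‖`.
If the minimum `m` of its spectrum were negative, the self-adjoint inequality at
`a = (y - m)^{1/2}` would bound `κ a² + a S(1) a - S(a) a - a S(a)` from below by a positive
multiple of `1`, while that element is small on the approximate null vectors of `a`. -/
theorem SelfAdjointInequality.nonneg_of_smul_sub {S : A →L[ℂ] A} (hS : SelfAdjointInequality S)
    (hs : IsSymmetricMap S) {κ : ℝ} (hκ : ‖S 1‖ < κ) {y : A} (hy : IsSelfAdjoint y)
    (h : 0 ≤ (κ : ℂ) • y - S y) : 0 ≤ y := by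
  nontriviality A
  by_contra hneg
  have hne : (spectrum ℝ y).Nonempty := ContinuousFunctionalCalculus.spectrum_nonempty y hy
  obtain ⟨m, hm, hmin⟩ := (ContinuousFunctionalCalculus.isCompact_spectrum (R := ℝ) y).exists_isLeast
    hne
  have hm0 : m < 0 := by
    by_contra hm0
    exact hneg ((StarOrderedRing.nonneg_iff_spectrum_nonneg (R := ℝ) y).2
      fun x hx => (not_lt.1 hm0).trans (hmin hx))
  set b : A := y - algebraMap ℝ A m with hb
  have hb0 : 0 ≤ b := sub_nonneg.2 ((algebraMap_le_iff_le_spectrum (a := y) (r := m)).2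
    fun x hx => hmin hx)
  set a : A := CFC.sqrt b with ha
  have ha0 : 0 ≤ a := CFC.sqrt_nonneg b
  have haa : a * a = b := CFC.sqrt_mul_sqrt_self b
  have hasa : IsSelfAdjoint a := ha0.isSelfAdjoint
  have hau : ¬ IsUnit a := fun hu => by
    have h1 : IsUnit b := haa ▸ hu.mul hu
    rw [spectrum.mem_iff, ← IsUnit.neg_iff, neg_sub] at hm
    exact hm h1
  have hκ0 : 0 < κ := (norm_nonneg _).trans_lt hκ
  set δ : ℝ := -m * (κ - ‖S 1‖) with hδ
  have hδ0 : 0 < δ := mul_pos (by linarith) (by linarith)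
  set W : A := (κ : ℂ) • (a * a) + a * S 1 * a - (S a * a + a * S a) with hW
  have hWδ : algebraMap ℝ A δ ≤ W := by
    have h1 := hS a hasa
    have hS1 : S 1 ≤ algebraMap ℝ A ‖S 1‖ := by
      refine IsSelfAdjoint.le_algebraMap_norm_self ?_
      have := hs 1
      rw [star_one] at this
      exact this.symm
    have h2 : (-m) • S 1 ≤ (-m) • algebraMap ℝ A ‖S 1‖ :=
      smul_le_smul_of_nonneg_left hS1 (by linarith)
    have hSm : S (algebraMap ℝ A m) = m • S 1 := by
      rw [Algebra.algebraMap_eq_smul_one, ← Complex.coe_smul, map_smul, Complex.coe_smul]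
    have hyb : y = b + algebraMap ℝ A m := by rw [hb]; abel
    rw [hyb, map_add, hSm, smul_add] at h
    rw [sq, haa] at h1
    rw [hW, haa]
    have e1 : algebraMap ℝ A δ = -((κ : ℂ) • algebraMap ℝ A m) - (-m) • algebraMap ℝ A ‖S 1‖ := by
      simp only [hδ, Algebra.algebraMap_eq_smul_one, Complex.coe_smul, smul_smul, ← neg_smul,
        ← sub_smul]
      congr 1; ring
    rw [e1]
    have h3 := add_le_add (add_le_add h h1) h2
    rw [← sub_nonneg] at h3 ⊢
    convert h3 using 1
    simp only [neg_smul]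
    abel
  set C : ℝ := κ + ‖S 1‖ + 2 * ‖S a‖ with hC
  have hC0 : 0 < C := by positivity
  obtain ⟨e, hesa, he1, hae⟩ := exists_one_le_norm_norm_mul_le ha0 hau
    (ε := min 1 (δ / (2 * C))) (by positivity)
  have hea : ‖e * a‖ = ‖a * e‖ := by
    rw [← norm_star, star_mul, hesa.star_eq, hasa.star_eq]
  set η : ℝ := ‖a * e‖ with hη
  have hη0 : 0 ≤ η := norm_nonneg _
  have hη1 : η ≤ 1 := hae.trans (min_le_left _ _)
  have hηδ : C * η ≤ δ / 2 := by
    have := hae.trans (min_le_right _ _)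
    rw [le_div_iff₀ (by positivity)] at this
    linarith
  -- Conjugating `δ ≤ W` by the approximate null vector `e` gives incompatible bounds on `e W e`.
  have hlow : δ * ‖e‖ ≤ ‖e * W * e‖ := by
    have h1 := star_left_conjugate_le_conjugate hWδ e
    have h2 : (0 : A) ≤ star e * algebraMap ℝ A δ * e := by
      rw [Algebra.algebraMap_eq_smul_one, mul_smul_comm, smul_mul_assoc, mul_one]
      exact smul_nonneg hδ0.le (star_mul_self_nonneg e)
    have h3 := CStarAlgebra.norm_le_norm_of_nonneg_of_le h2 h1
    rw [Algebra.algebraMap_eq_smul_one, mul_smul_comm, smul_mul_assoc, mul_one, norm_smul,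
      CStarRing.norm_star_mul_self, Real.norm_of_nonneg hδ0.le, hesa.star_eq] at h3
    refine le_trans (mul_le_mul_of_nonneg_left ?_ hδ0.le) h3
    nlinarith
  have hup : ‖e * W * e‖ ≤ C * η * ‖e‖ := by
    have e1 : e * W * e = (κ : ℂ) • ((e * a) * (a * e)) + (e * a) * S 1 * (a * e) -
        (e * S a * (a * e) + (e * a) * (S a * e)) := by
      simp only [hW, mul_add, mul_sub, add_mul, sub_mul, mul_smul_comm, smul_mul_assoc, mul_assoc]
    have h1 : ‖(κ : ℂ) • ((e * a) * (a * e))‖ ≤ κ * (η * η) := by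
      rw [norm_smul, Complex.norm_real, Real.norm_of_nonneg hκ0.le]
      exact mul_le_mul_of_nonneg_left ((norm_mul_le _ _).trans_eq (by rw [hea])) hκ0.le
    have h2 : ‖(e * a) * S 1 * (a * e)‖ ≤ η * ‖S 1‖ * η :=
      (norm_mul₃_le).trans_eq (by rw [hea])
    have h3 : ‖e * S a * (a * e)‖ ≤ ‖e‖ * ‖S a‖ * η := norm_mul₃_le
    have h4 : ‖(e * a) * (S a * e)‖ ≤ η * (‖S a‖ * ‖e‖) :=
      (norm_mul_le _ _).trans (by rw [hea]; gcongr; exact norm_mul_le _ _)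
    have hηe : η * η ≤ η * ‖e‖ := mul_le_mul_of_nonneg_left (hη1.trans he1) hη0
    have h5 : κ * (η * η) ≤ κ * (η * ‖e‖) := mul_le_mul_of_nonneg_left hηe hκ0.le
    have h6 : ‖S 1‖ * (η * η) ≤ ‖S 1‖ * (η * ‖e‖) :=
      mul_le_mul_of_nonneg_left hηe (norm_nonneg _)
    rw [e1]
    refine (norm_sub_le _ _).trans ((add_le_add (norm_add_le _ _) (norm_add_le _ _)).trans ?_)
    rw [hC]
    linarith
  have : C * η * ‖e‖ ≤ δ / 2 * ‖e‖ := mul_le_mul_of_nonneg_right hηδ (norm_nonneg _)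
  nlinarith [mul_pos hδ0 (zero_lt_one.trans_le he1)]

theorem IsPositiveMap.mul {A : Type*} [NormedRing A] [NormedAlgebra ℂ A] [PartialOrder A]
    {S R : A →L[ℂ] A} (hS : IsPositiveMap S) (hR : IsPositiveMap R) :
    IsPositiveMap (S * R) := fun a ha => hS _ (hR a ha)

theorem IsPositiveMap.pow {A : Type*} [NormedRing A] [NormedAlgebra ℂ A] [PartialOrder A]
    {S : A →L[ℂ] A} (hS : IsPositiveMap S) (n : ℕ) :
    IsPositiveMap (S ^ n) := by
  induction n with
  | zero => exact fun _ ha => ha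
  | succ n ih => exact ih.mul hS

theorem isClosed_setOf_isPositiveMap : IsClosed {S : A →L[ℂ] A | IsPositiveMap S} := by
  simp only [IsPositiveMap, Set.ofPred_forall]
  refine isClosed_iInter fun a => isClosed_iInter fun _ => ?_
  exact isClosed_le continuous_const (ContinuousLinearMap.apply ℂ A a).continuous

/-- Positivity of the resolvent at `κ` passes to `κ - ε` for `ε ‖(κ - S)⁻¹‖ < 1`, by the Neumann
series. -/
theorem IsPositiveMap.inverse_sub {S : A →L[ℂ] A} {κ ε : ℝ} (hε : 0 ≤ ε)
    (hu : IsUnit ((κ : ℂ) • (1 : A →L[ℂ] A) - S))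
    (hP : IsPositiveMap (Ring.inverse ((κ : ℂ) • (1 : A →L[ℂ] A) - S)))
    (hlt : ε * ‖Ring.inverse ((κ : ℂ) • (1 : A →L[ℂ] A) - S)‖ < 1) :
    IsPositiveMap (Ring.inverse (((κ - ε : ℝ) : ℂ) • (1 : A →L[ℂ] A) - S)) := by
  set P := Ring.inverse ((κ : ℂ) • (1 : A →L[ℂ] A) - S) with hPdef
  have hn : ‖(ε : ℂ) • P‖ < 1 := by
    rwa [norm_smul, Complex.norm_real, Real.norm_of_nonneg hε]
  have hε' : IsPositiveMap ((ε : ℂ) • P) := fun a ha => by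
    rw [smul_apply, Complex.coe_smul]
    exact smul_nonneg hε (hP a ha)
  have hsum : IsPositiveMap (∑' n : ℕ, ((ε : ℂ) • P) ^ n) := by
    refine isClosed_setOf_isPositiveMap.mem_of_tendsto
      (summable_geometric_of_norm_lt_one hn).hasSum.tendsto_sum_nat
      (.of_forall fun n a ha => ?_)
    rw [sum_apply]
    exact Finset.sum_nonneg fun i _ => hε'.pow i a ha
  rw [inverse_smul_sub_eq_tsum_mul (S := S) hu hn]
  exact hsum.mul hP

/-- If `S` satisfies the self-adjoint inequality, then its resolvent is positive on every half-line
on which it exists: it is so near infinity, and positivity propagates downwards. -/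
theorem SelfAdjointInequality.isPositiveMap_inverse {S : A →L[ℂ] A} (hS : SelfAdjointInequality S)
    (hs : IsSymmetricMap S) {κ₀ : ℝ}
    (hu : ∀ κ : ℝ, κ₀ < κ → IsUnit ((κ : ℂ) • (1 : A →L[ℂ] A) - S)) {κ : ℝ} (hκ : κ₀ < κ) :
    IsPositiveMap (Ring.inverse ((κ : ℂ) • (1 : A →L[ℂ] A) - S)) := by
  have hbase : ∀ μ : ℝ, κ₀ < μ → ‖S 1‖ < μ →
      IsPositiveMap (Ring.inverse ((μ : ℂ) • (1 : A →L[ℂ] A) - S)) := by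
    intro μ hμ hμ1 x hx
    set P := Ring.inverse ((μ : ℂ) • (1 : A →L[ℂ] A) - S) with hP
    have hR : ∀ z, (μ : ℂ) • P z - S (P z) = z := fun z => by
      have := congrArg (fun V : A →L[ℂ] A => V z) (Ring.mul_inverse_cancel _ (hu μ hμ))
      simpa using this
    have hL : ∀ z, P ((μ : ℂ) • z - S z) = z := fun z => by
      have := congrArg (fun V : A →L[ℂ] A => V z) (Ring.inverse_mul_cancel _ (hu μ hμ))
      simpa using this
    have hsa : IsSelfAdjoint (P x) := by
      have h1 := congrArg star (hR x)
      rw [star_sub, star_smul, ← hs, (IsSelfAdjoint.of_nonneg hx).star_eq] at h1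
      have h2 := hL (star (P x))
      simp only [Complex.star_def, Complex.conj_ofReal] at h1
      rw [h1] at h2
      exact h2.symm
    exact hS.nonneg_of_smul_sub hs hμ1 hsa (by rw [hR]; exact hx)
  obtain ⟨κ₁, hκ₁, hκ₁'⟩ : ∃ κ₁, κ < κ₁ ∧ ‖S 1‖ < κ₁ :=
    ⟨max κ ‖S 1‖ + 1, (le_max_left _ _).trans_lt (lt_add_one _),
      (le_max_right _ _).trans_lt (lt_add_one _)⟩
  have hcont : ContinuousOn (fun μ : ℝ => ‖Ring.inverse ((μ : ℂ) • (1 : A →L[ℂ] A) - S)‖)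
      (Set.Icc κ κ₁) := fun μ hμ => by
    obtain ⟨v, hv⟩ := hu μ (hκ.trans_le hμ.1)
    have h1 : ContinuousAt Ring.inverse ((μ : ℂ) • (1 : A →L[ℂ] A) - S) :=
      hv ▸ NormedRing.inverse_continuousAt v
    have h2 : ContinuousAt (fun μ : ℝ => (μ : ℂ) • (1 : A →L[ℂ] A) - S) μ := by fun_prop
    exact (ContinuousAt.comp (f := fun μ : ℝ => (μ : ℂ) • (1 : A →L[ℂ] A) - S) h1
      h2).norm.continuousWithinAt
  obtain ⟨C, hC⟩ := isCompact_Icc.bddAbove_image hcont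
  have hC' : ∀ μ ∈ Set.Icc κ κ₁, ‖Ring.inverse ((μ : ℂ) • (1 : A →L[ℂ] A) - S)‖ ≤ C :=
    fun μ hμ => hC (Set.mem_image_of_mem _ hμ)
  have hC0 : 0 ≤ C := (norm_nonneg _).trans (hC' κ ⟨le_rfl, hκ₁.le⟩)
  -- The resolvent is bounded by `C` on `[κ, κ₁]`, so `n` steps of one fixed length `ε < C⁻¹` lead
  -- from `κ₁` down to `κ`.
  obtain ⟨n, hn⟩ := exists_nat_gt ((κ₁ - κ) * C)
  have hn0 : (0 : ℝ) < n := (mul_nonneg (by linarith) hC0).trans_lt hn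
  set ε : ℝ := (κ₁ - κ) / n with hε
  have hε0 : 0 < ε := div_pos (by linarith) hn0
  have hεC : ε * C < 1 := by
    rw [hε, div_mul_eq_mul_div, div_lt_one hn0]; exact hn
  have hnε : n * ε = κ₁ - κ := by rw [hε]; field_simp
  have hstep : ∀ k : ℕ, k ≤ n →
      IsPositiveMap (Ring.inverse (((κ₁ - k * ε : ℝ) : ℂ) • (1 : A →L[ℂ] A) - S)) := by
    intro k
    induction k with
    | zero => intro _; simpa using hbase κ₁ (hκ.trans hκ₁) hκ₁'
    | succ k ih =>
      intro hk
      have hkn : (k : ℝ) + 1 ≤ n := by exact_mod_cast hk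
      have hmem : κ₁ - k * ε ∈ Set.Icc κ κ₁ := by
        constructor
        · nlinarith
        · have : 0 ≤ k * ε := by positivity
          linarith
      have := (ih (by omega)).inverse_sub hε0.le (hu _ (hκ.trans_le hmem.1))
        ((mul_le_mul_of_nonneg_left (hC' _ hmem) hε0.le).trans_lt hεC)
      convert this using 4
      push_cast
      ring
  have := hstep n le_rfl
  rwa [hnε, sub_sub_cancel] at this

end BoundedResolvent

/-! ### Resolvents of an unbounded generator -/

section ResolventFamily

section

variable {A : Type*} [NormedRing A] [NormedAlgebra ℂ A] {L : A →ₗ.[ℂ] A}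

theorem IsResolvent.unique {lam : ℝ} {R R' : A →L[ℂ] A} (hR : IsResolvent L lam R)
    (hR' : IsResolvent L lam R') : R = R' := by
  ext x
  obtain ⟨h, hx⟩ := hR'.1 x
  have := hR.2 ⟨R' x, h⟩
  rwa [hx] at this

/-- The resolvent identity. -/
theorem IsResolvent.sub_apply {lam μ : ℝ} {R R' : A →L[ℂ] A} (hR : IsResolvent L lam R)
    (hR' : IsResolvent L μ R') (x : A) : R x - R' x = ((μ - lam : ℝ) : ℂ) • R (R' x) := by
  obtain ⟨h, hx⟩ := hR'.1 x
  have h1 := hR.2 ⟨R' x, h⟩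
  have h2 : (lam : ℂ) • R' x - L ⟨R' x, h⟩ = ((lam - μ : ℝ) : ℂ) • R' x + x := by
    nth_rewrite 4 [← hx]
    rw [Complex.ofReal_sub, sub_smul]
    abel
  simp only [h2, map_add, map_smul] at h1
  rw [← neg_sub lam μ, Complex.ofReal_neg]
  linear_combination (norm := module) h1

/-- For `ν = lam - κ⁻¹`, the inverse of `κ - (lam - L)⁻¹` is `κ⁻¹ (1 + κ⁻¹ (ν - L)⁻¹)`. -/
theorem IsResolvent.smul_sub_mul {lam ν κ : ℝ} {R R' : A →L[ℂ] A} (hR : IsResolvent L lam R)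
    (hR' : IsResolvent L ν R') (hκ : κ ≠ 0) (hν : ν = lam - κ⁻¹) :
    ((κ : ℂ) • (1 : A →L[ℂ] A) - R) * ((κ⁻¹ : ℝ) : ℂ) • (1 + ((κ⁻¹ : ℝ) : ℂ) • R') = 1 ∧
    ((κ⁻¹ : ℝ) : ℂ) • (1 + ((κ⁻¹ : ℝ) : ℂ) • R') * ((κ : ℂ) • (1 : A →L[ℂ] A) - R) = 1 := by
  have hc : (κ : ℂ) * ((κ⁻¹ : ℝ) : ℂ) = 1 := by
    rw [← Complex.ofReal_mul, mul_inv_cancel₀ hκ, Complex.ofReal_one]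
  set c : ℂ := ((κ⁻¹ : ℝ) : ℂ) with hcdef
  have hκc : ∀ v : A, (κ : ℂ) • c • v = v := fun v => by rw [smul_smul, hc, one_smul]
  have hcκ : ∀ v : A, c • (κ : ℂ) • v = v := fun v => by rw [smul_comm, hκc]
  have e1 : ν - lam = -κ⁻¹ := by rw [hν]; ring
  have e2 : lam - ν = κ⁻¹ := by rw [hν]; ring
  constructor
  · ext x
    have h := hR.sub_apply hR' x
    rw [e1, Complex.ofReal_neg, neg_smul, ← hcdef, sub_eq_iff_eq_add] at h
    change (κ : ℂ) • c • (x + c • R' x) - R (c • (x + c • R' x)) = x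
    rw [hκc, map_smul, map_add, map_smul, h]
    module
  · ext x
    have h := hR'.sub_apply hR x
    rw [e2, ← hcdef, sub_eq_iff_eq_add] at h
    change c • (((κ : ℂ) • x - R x) + c • R' ((κ : ℂ) • x - R x)) = x
    rw [map_sub, map_smul, smul_add, smul_sub, smul_sub, hcκ, hcκ, h]
    module

end

variable {A : Type*} [CStarAlgebra A] [PartialOrder A] [StarOrderedRing A] {L : A →ₗ.[ℂ] A}

/-- The self-adjoint inequality for all resolvents of a half-line forces their positivity: for
`μ < lam`, the inverse of `(lam - μ)⁻¹ - (lam - L)⁻¹` is a positive multiple of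
`(lam - μ)⁻¹ + (μ - L)⁻¹`, hence positive, and `lam` can be sent to infinity. -/
theorem isPositiveMap_of_forall_selfAdjointInequality {ω : ℝ} {R : ℝ → A →L[ℂ] A}
    (hR : ∀ lam, ω < lam → IsResolvent L lam (R lam)) (hs : ∀ lam, ω < lam → IsSymmetricMap (R lam))
    (hS : ∀ lam, ω < lam → SelfAdjointInequality (R lam)) {μ : ℝ} (hμ : ω < μ) :
    IsPositiveMap (R μ) := by
  intro x hx
  have hpos : ∀ lam, μ < lam → 0 ≤ (lam - μ)⁻¹ • x + R μ x := by
    intro lam hlam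
    have hωl : ω < lam := hμ.trans hlam
    have hinv : ∀ κ : ℝ, (lam - ω)⁻¹ < κ → 0 < κ ∧ ω < lam - κ⁻¹ := by
      intro κ hκ
      have h0 : 0 < κ := (inv_pos.2 (sub_pos.2 hωl)).trans hκ
      have := inv_lt_of_inv_lt₀ (sub_pos.2 hωl) hκ
      exact ⟨h0, by linarith⟩
    have hu : ∀ κ : ℝ, (lam - ω)⁻¹ < κ → IsUnit ((κ : ℂ) • (1 : A →L[ℂ] A) - R lam) := by
      intro κ hκ
      obtain ⟨h0, hν⟩ := hinv κ hκ
      obtain ⟨h1, h2⟩ := (hR lam hωl).smul_sub_mul (hR _ hν) h0.ne' rfl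
      exact ⟨⟨_, _, h1, h2⟩, rfl⟩
    have hκ : (lam - ω)⁻¹ < (lam - μ)⁻¹ :=
      (inv_lt_inv₀ (sub_pos.2 hωl) (sub_pos.2 hlam)).2 (by linarith)
    have hP := (hS lam hωl).isPositiveMap_inverse (hs lam hωl) hu hκ x hx
    obtain ⟨h1, h2⟩ := (hR lam hωl).smul_sub_mul (hR μ hμ) (hinv _ hκ).1.ne'
      (by rw [inv_inv]; ring)
    have hP' : Ring.inverse ((((lam - μ)⁻¹ : ℝ) : ℂ) • (1 : A →L[ℂ] A) - R lam) = _ :=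
      Ring.inverse_unit ⟨_, _, h1, h2⟩
    rw [hP'] at hP
    have hd : 0 < lam - μ := sub_pos.2 hlam
    have h3 := smul_nonneg (mul_nonneg (inv_nonneg.2 hd.le) (inv_nonneg.2 hd.le)) hP
    convert h3 using 1
    simp only [Units.inv_mk, inv_inv, smul_apply, add_apply,
      one_apply_eq_self, Complex.coe_smul, smul_add, smul_smul]
    congr 1
    · congr 1; field_simp
    · rw [← Complex.ofReal_mul, Complex.coe_smul, smul_smul,
        show (lam - μ)⁻¹ * (lam - μ)⁻¹ * ((lam - μ) * (lam - μ)) = 1 by field_simp, one_smul]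
  have hlim : Tendsto (fun lam : ℝ => (lam - μ)⁻¹ • x + R μ x) atTop (𝓝 ((0 : ℝ) • x + R μ x)) := by
    refine Tendsto.add (Tendsto.smul_const ?_ x) tendsto_const_nhds
    exact tendsto_inv_atTop_zero.comp (tendsto_atTop_add_const_right _ (-μ) tendsto_id)
  rw [zero_smul, zero_add] at hlim
  exact ge_of_tendsto hlim ((eventually_gt_atTop μ).mono hpos)

end ResolventFamily

/-! ### Laplace transforms of exponentially bounded functions -/

section LaplaceTransform

open MeasureTheory Set Asymptotics

variable {E : Type*} [NormedAddCommGroup E] [NormedSpace ℝ E]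

theorem isBigO_pow_mul_exp_smul {f : ℝ → E} {C ω : ℝ}
    (hf : ∀ r, 0 ≤ r → ‖f r‖ ≤ C * Real.exp (ω * r)) {lam : ℝ} (hlam : ω < lam) (k : ℕ) :
    (fun r : ℝ => (r ^ k * Real.exp (-lam * r)) • f r) =O[atTop]
      fun r => Real.exp (-((lam - ω) / 2) * r) := by
  have h1 : (fun r : ℝ => r ^ k) =O[atTop] fun r => Real.exp ((lam - ω) / 2 * r) :=
    (isLittleO_pow_exp_pos_mul_atTop k (by linarith)).isBigO
  have h2 : (fun r : ℝ => Real.exp (-lam * r) • f r) =O[atTop]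
      fun r => Real.exp (-lam * r) * Real.exp (ω * r) := by
    refine IsBigO.of_bound C ?_
    filter_upwards [eventually_ge_atTop 0] with r hr
    have := mul_le_mul_of_nonneg_left (hf r hr) (Real.exp_pos (-lam * r)).le
    rw [norm_smul, norm_mul, Real.norm_of_nonneg (Real.exp_pos _).le,
      Real.norm_of_nonneg (Real.exp_pos _).le]
    linarith
  refine ((h1.smul h2).congr_left fun r => by rw [smul_smul]).congr_right fun r => ?_
  rw [smul_eq_mul, ← Real.exp_add, ← Real.exp_add]
  congr 1
  ring

theorem integrableOn_pow_mul_exp_smul {f : ℝ → E} (hc : Continuous f) {C ω : ℝ}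
    (hf : ∀ r, 0 ≤ r → ‖f r‖ ≤ C * Real.exp (ω * r)) {lam : ℝ} (hlam : ω < lam) (k : ℕ) :
    IntegrableOn (fun r : ℝ => (r ^ k * Real.exp (-lam * r)) • f r) (Ioi 0) := by
  have hcont : Continuous fun r : ℝ => (r ^ k * Real.exp (-lam * r)) • f r := by fun_prop
  have h := integrable_of_isBigO_exp_neg (a := 0) (b := (lam - ω) / 2) (by linarith)
    hcont.norm.continuousOn (isBigO_pow_mul_exp_smul hf hlam k).norm_left
  exact (integrable_norm_iff hcont.aestronglyMeasurable).1 h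

theorem tendsto_pow_mul_exp_smul {f : ℝ → E} {C ω : ℝ}
    (hf : ∀ r, 0 ≤ r → ‖f r‖ ≤ C * Real.exp (ω * r)) {lam : ℝ} (hlam : ω < lam) (k : ℕ) :
    Tendsto (fun r : ℝ => (r ^ k * Real.exp (-lam * r)) • f r) atTop (𝓝 0) := by
  refine (isBigO_pow_mul_exp_smul hf hlam k).trans_tendsto ?_
  refine Real.tendsto_exp_atBot.comp ?_
  exact tendsto_id.const_mul_atTop_of_neg (by linarith)

theorem integrableOn_exp_smul {f : ℝ → E} (hc : Continuous f) {C ω : ℝ}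
    (hf : ∀ r, 0 ≤ r → ‖f r‖ ≤ C * Real.exp (ω * r)) {lam : ℝ} (hlam : ω < lam) :
    IntegrableOn (fun r : ℝ => Real.exp (-lam * r) • f r) (Ioi 0) := by
  simpa using integrableOn_pow_mul_exp_smul hc hf hlam 0

/-- The functions `u e^{1-u}` peak at `u = 1`. -/
theorem mul_exp_one_sub_le {u v : ℝ} (h : u ≤ v ∧ v ≤ 1 ∨ v ≤ u ∧ 1 ≤ v) (hv : 0 < v) :
    u * Real.exp (1 - u) ≤ v * Real.exp (1 - v) := by
  have h1 : u ≤ v * Real.exp (u - v) := by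
    have h2 : u / v ≤ Real.exp (u - v) := by
      refine le_trans ?_ (Real.add_one_le_exp _)
      rw [div_le_iff₀ hv]
      rcases h with ⟨h, h'⟩ | ⟨h, h'⟩ <;> nlinarith
    rwa [div_le_iff₀ hv, mul_comm] at h2
  calc u * Real.exp (1 - u) ≤ v * Real.exp (u - v) * Real.exp (1 - u) :=
        mul_le_mul_of_nonneg_right h1 (Real.exp_pos _).le
    _ = v * Real.exp (1 - v) := by rw [mul_assoc, ← Real.exp_add]; congr 2; ring

theorem mul_exp_one_sub_lt_one {u : ℝ} (hu : u ≠ 1) : u * Real.exp (1 - u) < 1 := by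
  have := Real.add_one_lt_exp (sub_ne_zero.2 hu)
  rw [sub_add_cancel] at this
  calc u * Real.exp (1 - u) < Real.exp (u - 1) * Real.exp (1 - u) :=
        mul_lt_mul_of_pos_right this (Real.exp_pos _)
    _ = 1 := by rw [← Real.exp_add]; simp

/-- A weak form of the Post–Widder inversion formula: if the Laplace transform of `g` is completely
monotone near infinity, then `g ≥ 0`. If `g t < 0`, then `∫ (r/t · e^{1 - r/t})ⁿ e^{-lam r} g r dr`
is eventually negative, because the weights concentrate at `r = t`. -/
theorem nonneg_of_forall_integral_pow_mul_exp_nonneg {g : ℝ → ℝ} (hc : Continuous g) {C ω : ℝ}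
    (hg : ∀ r, 0 ≤ r → ‖g r‖ ≤ C * Real.exp (ω * r)) {lam₀ : ℝ} (hlam : ω < lam₀)
    (hpos : ∀ lam, lam₀ ≤ lam → ∀ k : ℕ,
      0 ≤ ∫ r in Ioi (0 : ℝ), r ^ k * Real.exp (-lam * r) * g r) {t : ℝ} (ht : 0 < t) :
    0 ≤ g t := by
  by_contra! hneg
  set h : ℝ → ℝ := fun r => Real.exp (-lam₀ * r) * g r with hh
  have hhc : Continuous h := by fun_prop
  have hhi : IntegrableOn h (Ioi 0) := by
    exact integrableOn_exp_smul hc hg hlam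
  set c : ℝ → ℝ := fun r => r / t * Real.exp (1 - r / t) with hcdef
  have hcc : Continuous c := by fun_prop
  have hc0 : ∀ r, 0 ≤ r → 0 ≤ c r := fun r hr => by positivity
  have haux : ∀ (n : ℕ) (r : ℝ), (Real.exp 1 / t) ^ n *
      (r ^ n * Real.exp (-(lam₀ + n / t) * r) * g r) = c r ^ n * h r := fun n r => by
    have h1 : Real.exp (-(lam₀ + n / t) * r) = Real.exp (-lam₀ * r) * Real.exp (-(r / t)) ^ n := by
      rw [← Real.exp_nat_mul, ← Real.exp_add]; congr 1; ring
    have h2 : Real.exp (1 - r / t) = Real.exp 1 * Real.exp (-(r / t)) := by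
      rw [← Real.exp_add, sub_eq_add_neg]
    simp only [hcdef, hh, h1, h2, mul_pow, div_pow]
    ring
  have hint : ∀ n : ℕ, IntegrableOn (fun r => c r ^ n * h r) (Ioi 0) := fun n => by
    have h1 := (integrableOn_pow_mul_exp_smul hc hg (lam := lam₀ + n / t)
      (by have : (0 : ℝ) ≤ n / t := by positivity
          linarith) n).const_mul ((Real.exp 1 / t) ^ n)
    exact h1.congr (Eventually.of_forall fun r => haux n r)
  have hI : ∀ n : ℕ, 0 ≤ ∫ r in Ioi (0 : ℝ), c r ^ n * h r := fun n => by
    have h1 := hpos (lam₀ + n / t) (by have : (0 : ℝ) ≤ n / t := by positivity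
                                       linarith) n
    have h2 := mul_nonneg (pow_nonneg (div_pos (Real.exp_pos 1) ht).le n) h1
    rw [← integral_const_mul] at h2
    exact h2.trans_eq (integral_congr_ae (Eventually.of_forall fun r => haux n r))
  have hht : h t < 0 := mul_neg_of_pos_of_neg (Real.exp_pos _) hneg
  -- `h ≤ h t / 2 < 0` on a neighbourhood of `t` of radius `δ`
  obtain ⟨δ, hδ0, hδt, hδ⟩ : ∃ δ, 0 < δ ∧ δ < t ∧ ∀ r, |r - t| ≤ δ → h r ≤ h t / 2 := by
    have : ∀ᶠ r in 𝓝 t, h r < h t / 2 := hhc.continuousAt.eventually_lt_const (by linarith)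
    obtain ⟨δ, hδ0, hδ⟩ := Metric.eventually_nhds_iff.1 this
    refine ⟨min (δ / 2) (t / 2), by positivity, ?_, fun r hr => (hδ ?_).le⟩
    · exact (min_le_right _ _).trans_lt (by linarith)
    · rw [Real.dist_eq]
      exact (hr.trans (min_le_left _ _)).trans_lt (by linarith)
  set q : ℝ := max (c (t - δ)) (c (t + δ)) with hq
  have hq0 : 0 ≤ q := (hc0 _ (by linarith)).trans (le_max_left _ _)
  have hq1 : q < 1 := by
    refine max_lt (mul_exp_one_sub_lt_one ?_) (mul_exp_one_sub_lt_one ?_)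
    · rw [Ne, div_eq_one_iff_eq ht.ne']; linarith
    · rw [Ne, div_eq_one_iff_eq ht.ne']; linarith
  have hfar : ∀ r, 0 ≤ r → δ ≤ |r - t| → c r ≤ q := by
    intro r hr hrt
    rcases le_abs.1 hrt with h1 | h1
    · refine le_max_of_le_right (mul_exp_one_sub_le (Or.inr ⟨?_, ?_⟩) (by positivity))
      · gcongr; linarith
      · rw [one_le_div ht]; linarith
    · refine le_max_of_le_left (mul_exp_one_sub_le (Or.inl ⟨?_, ?_⟩) (div_pos (by linarith) ht))
      · gcongr; linarith
      · rw [div_le_one ht]; linarith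
  -- Any `p` strictly between `q` and `1` serves: `c ≥ p` close to `t`, and `(q / p)ⁿ → 0`.
  set p : ℝ := (1 + q) / 2 with hp
  have hqp : q < p := by rw [hp]; linarith
  have hp0 : 0 < p := hq0.trans_lt hqp
  obtain ⟨ε, hε0, hεδ, hε⟩ : ∃ ε, 0 < ε ∧ ε < δ ∧ ∀ r, |r - t| ≤ ε → p ≤ c r := by
    have hct : c t = 1 := by simp [hcdef, ht.ne']
    have : ∀ᶠ r in 𝓝 t, p < c r := by
      refine hcc.continuousAt.eventually_const_lt ?_
      rw [hct, hp]; linarith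
    obtain ⟨ε, hε0, hε⟩ := Metric.eventually_nhds_iff.1 this
    refine ⟨min (ε / 2) (δ / 2), by positivity, ?_, fun r hr => (hε ?_).le⟩
    · exact (min_le_right _ _).trans_lt (by linarith)
    · rw [Real.dist_eq]
      exact (hr.trans (min_le_left _ _)).trans_lt (by linarith)
  set D : ℝ := ∫ r in Ioi (0 : ℝ), |h r| with hD
  have hD0 : 0 ≤ D := integral_nonneg fun r => abs_nonneg _
  -- This integrates the pointwise bound `cⁿ h ≤ qⁿ |h| + pⁿ (h t / 2) 1_{[t - ε, t + ε]}`.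
  have hub : ∀ n : ℕ, ∫ r in Ioi (0 : ℝ), c r ^ n * h r ≤ q ^ n * D + p ^ n * (h t / 2) * (2 * ε) := by
    intro n
    have hsub : Icc (t - ε) (t + ε) ⊆ Ioi 0 := fun r hr => by
      have := hr.1; simp only [mem_Ioi]; linarith
    have hi1 : IntegrableOn (fun r => q ^ n * |h r|) (Ioi 0) := hhi.abs.const_mul _
    have hi2 : IntegrableOn ((Icc (t - ε) (t + ε)).indicator fun _ => p ^ n * (h t / 2)) (Ioi 0) :=
      ((integrableOn_const (by simp)).integrable_indicator measurableSet_Icc).integrableOn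
    have hle : ∫ r in Ioi (0 : ℝ), c r ^ n * h r ≤ ∫ r in Ioi (0 : ℝ), (q ^ n * |h r| +
        (Icc (t - ε) (t + ε)).indicator (fun _ => p ^ n * (h t / 2)) r) := by
      refine setIntegral_mono_on (hint n) (hi1.add hi2) measurableSet_Ioi fun r hr => ?_
      have hr0 : 0 ≤ r := (mem_Ioi.1 hr).le
      by_cases hrI : r ∈ Icc (t - ε) (t + ε)
      · rw [indicator_of_mem hrI]
        have hrε : |r - t| ≤ ε := abs_le.2 ⟨by linarith [hrI.1], by linarith [hrI.2]⟩
        have h1 := hδ r (hrε.trans hεδ.le)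
        have h2 : p ^ n ≤ c r ^ n := pow_le_pow_left₀ hp0.le (hε r hrε) n
        have h3 : 0 ≤ q ^ n * |h r| := by positivity
        nlinarith [pow_pos hp0 n]
      · rw [indicator_of_notMem hrI, add_zero]
        rcases le_total δ |r - t| with h1 | h1
        · calc c r ^ n * h r ≤ c r ^ n * |h r| :=
                mul_le_mul_of_nonneg_left (le_abs_self _) (pow_nonneg (hc0 r hr0) n)
            _ ≤ q ^ n * |h r| := mul_le_mul_of_nonneg_right
                (pow_le_pow_left₀ (hc0 r hr0) (hfar r hr0 h1) n) (abs_nonneg _)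
        · have h2 : h r ≤ 0 := (hδ r h1).trans (by linarith)
          have h3 : c r ^ n * h r ≤ 0 :=
            mul_nonpos_of_nonneg_of_nonpos (pow_nonneg (hc0 r hr0) n) h2
          exact h3.trans (by positivity)
    refine hle.trans_eq ?_
    rw [integral_add hi1 hi2, integral_const_mul, setIntegral_indicator measurableSet_Icc,
      inter_eq_self_of_subset_right hsub, setIntegral_const, smul_eq_mul, Real.volume_real_Icc_of_le
        (by linarith)]
    ring
  have hlim : Tendsto (fun n : ℕ => (q / p) ^ n * D) atTop (𝓝 (0 * D)) :=
    (tendsto_pow_atTop_nhds_zero_of_lt_one (by positivity) ((div_lt_one hp0).2 hqp)).mul_const D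
  have hge : ∀ n : ℕ, -(h t) * ε ≤ (q / p) ^ n * D := fun n => by
    have h1 := (hI n).trans (hub n)
    have hpn := pow_pos hp0 n
    rw [div_pow, div_mul_eq_mul_div, le_div_iff₀ hpn]
    linarith
  have := ge_of_tendsto' hlim hge
  rw [zero_mul] at this
  nlinarith

end LaplaceTransform

/-! ### Weakly continuous semigroups and their generators -/

section WeakSemigroup

open MeasureTheory Set

theorem integral_Ioi_comp_add_right {E : Type*} [NormedAddCommGroup E] [NormedSpace ℝ E]
    (f : ℝ → E) (s : ℝ) : ∫ r in Ioi (0 : ℝ), f (r + s) = ∫ r in Ioi s, f r := by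
  have := (measurePreserving_add_right volume s).setIntegral_preimage_emb
    (measurableEmbedding_addRight s) f (Ioi s)
  simpa using this

theorem tendsto_nhds_sigmaTopology {A : Type*} [NormedRing A] [NormedAlgebra ℂ A]
    {F : Set (StrongDual ℂ A)} {ι : Type*} {l : Filter ι} {u : ι → A} {y : A} :
    Tendsto u l (@nhds A (sigmaTopology F) y) ↔ ∀ η ∈ F, Tendsto (fun i => η (u i)) l (𝓝 (η y)) := by
  simp only [nhds_iInf, tendsto_iInf, nhds_induced, tendsto_comap_iff]
  rfl

theorem NNReal.tendsto_coe_nhdsGT_zero : Tendsto (fun t : ℝ≥0 => (t : ℝ)) (𝓝[>] 0) (𝓝[>] 0) := by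
  refine tendsto_nhdsWithin_iff.2 ⟨?_, ?_⟩
  · exact (NNReal.continuous_coe.tendsto' 0 0 rfl).mono_left nhdsWithin_le_nhds
  · filter_upwards [self_mem_nhdsWithin] with t ht using by simpa using ht

theorem Real.tendsto_toNNReal_nhdsGT_zero : Tendsto Real.toNNReal (𝓝[>] 0) (𝓝[>] 0) := by
  refine tendsto_nhdsWithin_iff.2 ⟨?_, ?_⟩
  · exact (continuous_real_toNNReal.tendsto' 0 0 Real.toNNReal_zero).mono_left nhdsWithin_le_nhds
  · filter_upwards [self_mem_nhdsWithin] with t ht using by simpa using ht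

variable {A : Type*} [CStarAlgebra A] [PartialOrder A]

/-- The common framework for strongly continuous and weak-* continuous semigroups on a
C*-algebra: an exponentially bounded semigroup `T` and a set `F` of functionals on which `T` acts
up to linear combinations, for which all orbits are weakly continuous, which detects positivity and
is stable under the bimodule operations and the involution, and for which the weak Laplace
transforms `∫ e^{-lam t} T_t dt` exist in `A` for `lam > ω`. -/
structure IsWeakSemigroup (F : Set (StrongDual ℂ A)) (T : ℝ≥0 → A →L[ℂ] A) (C ω : ℝ) : Prop
    extends IsOperatorSemigroup T where
  norm_le : ∀ t, ‖T t‖ ≤ C * Real.exp (ω * t)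
  continuous_time : ∀ η ∈ F, ∀ x, Continuous fun t : ℝ≥0 => η (T t x)
  comp_mem_span : ∀ η ∈ F, ∀ t, η ∘L T t ∈ Submodule.span ℂ F
  exists_mul : ∀ η ∈ F, ∀ a b : A, ∃ η' ∈ F, ∀ x, η' x = η (a * x * b)
  exists_star : ∀ η ∈ F, ∃ η' ∈ F, ∀ x, η' x = star (η (star x))
  nonneg : ∀ x : A, (∀ η ∈ F, (∀ a, 0 ≤ a → 0 ≤ (η a).re) → 0 ≤ (η x).re) → 0 ≤ x
  exists_laplace : ∀ lam, ω < lam → ∃ R : A →L[ℂ] A, ∀ η ∈ F, ∀ x,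
    η (R x) = ∫ t in Ioi (0 : ℝ), Real.exp (-lam * t) • η (T t.toNNReal x)

namespace IsWeakSemigroup

variable {F : Set (StrongDual ℂ A)} {T : ℝ≥0 → A →L[ℂ] A} {C ω : ℝ}

/-- The weak Laplace transform of the semigroup at `lam` (and `0` for `lam ≤ ω`). -/
noncomputable def laplace (h : IsWeakSemigroup F T C ω) (lam : ℝ) : A →L[ℂ] A := by
  classical
  exact if hlam : ω < lam then (h.exists_laplace lam hlam).choose else 0

theorem norm_orbit_le (h : IsWeakSemigroup F T C ω) (η : StrongDual ℂ A) (x : A) (r : ℝ)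
    (hr : 0 ≤ r) : ‖η (T r.toNNReal x)‖ ≤ (‖η‖ * C * ‖x‖) * Real.exp (ω * r) := by
  have h1 := (T r.toNNReal).le_of_opNorm_le (h.norm_le r.toNNReal) x
  rw [Real.coe_toNNReal r hr] at h1
  calc _ ≤ ‖η‖ * ‖T r.toNNReal x‖ := η.le_opNorm _
    _ ≤ ‖η‖ * (C * Real.exp (ω * r) * ‖x‖) := by gcongr
    _ = _ := by ring

theorem continuous_orbit (h : IsWeakSemigroup F T C ω) {η : StrongDual ℂ A}
    (hη : η ∈ Submodule.span ℂ F) (x : A) : Continuous fun r : ℝ => η (T r.toNNReal x) := by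
  induction hη using Submodule.span_induction with
  | mem η hη => exact (h.continuous_time η hη x).comp continuous_real_toNNReal
  | zero => exact continuous_const
  | add η₁ η₂ _ _ h₁ h₂ => exact h₁.add h₂
  | smul c η _ h₁ => exact h₁.const_smul c

theorem apply_laplace (h : IsWeakSemigroup F T C ω) {lam : ℝ} (hlam : ω < lam)
    {η : StrongDual ℂ A} (hη : η ∈ Submodule.span ℂ F) (x : A) :
    η (h.laplace lam x) = ∫ t in Ioi (0 : ℝ), Real.exp (-lam * t) • η (T t.toNNReal x) := by
  induction hη using Submodule.span_induction with
  | mem η hη =>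
    rw [laplace, dif_pos hlam]
    exact (h.exists_laplace lam hlam).choose_spec η hη x
  | zero => simp
  | add η₁ η₂ m₁ m₂ h₁ h₂ =>
    simp only [add_apply, smul_add, h₁, h₂]
    exact (integral_add
      (integrableOn_exp_smul (h.continuous_orbit m₁ x) (h.norm_orbit_le η₁ x) hlam)
      (integrableOn_exp_smul (h.continuous_orbit m₂ x) (h.norm_orbit_le η₂ x) hlam)).symm
  | smul c η _ h₁ =>
    simp only [smul_apply, smul_comm _ c, h₁]
    exact (integral_smul c _).symm

theorem comp_mem (h : IsWeakSemigroup F T C ω) {η : StrongDual ℂ A}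
    (hη : η ∈ Submodule.span ℂ F) (t : ℝ≥0) : η ∘L T t ∈ Submodule.span ℂ F := by
  induction hη using Submodule.span_induction with
  | mem η hη => exact h.comp_mem_span η hη t
  | zero => rw [ContinuousLinearMap.zero_comp]; exact zero_mem _
  | add η₁ η₂ _ _ h₁ h₂ => rw [ContinuousLinearMap.add_comp]; exact add_mem h₁ h₂
  | smul c η _ h₁ => rw [ContinuousLinearMap.smul_comp]; exact Submodule.smul_mem _ _ h₁

theorem ext_of_forall_apply_eq [StarOrderedRing A] (h : IsWeakSemigroup F T C ω) {x y : A}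
    (hxy : ∀ η ∈ F, η x = η y) : x = y := by
  refine le_antisymm (sub_nonneg.1 (h.nonneg _ fun η hη _ => ?_))
    (sub_nonneg.1 (h.nonneg _ fun η hη _ => ?_)) <;> simp [hxy η hη]

/-- `e^{-lam s} η(T_s R x) = ∫_s^∞ e^{-lam r} η(T_r x) dr` for the Laplace transform `R` at `lam`,
written as a difference so that the right-hand side is differentiable in `s` on the whole line. -/
theorem exp_smul_apply_laplace (h : IsWeakSemigroup F T C ω) {lam : ℝ} (hlam : ω < lam)
    {η : StrongDual ℂ A} (hη : η ∈ Submodule.span ℂ F) (x : A) {s : ℝ} (hs : 0 ≤ s) :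
    Real.exp (-lam * s) • η (T s.toNNReal (h.laplace lam x)) =
      η (h.laplace lam x) - ∫ r in (0 : ℝ)..s, Real.exp (-lam * r) • η (T r.toNNReal x) := by
  set f : ℝ → ℂ := fun r => Real.exp (-lam * r) • η (T r.toNNReal x) with hf
  have hint : IntegrableOn f (Ioi 0) :=
    integrableOn_exp_smul (h.continuous_orbit hη x) (h.norm_orbit_le η x) hlam
  have h1 := h.apply_laplace hlam (h.comp_mem hη s.toNNReal) x
  rw [ContinuousLinearMap.comp_apply] at h1
  rw [h1, h.apply_laplace hlam hη x, ← integral_smul,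
    ← intervalIntegral.integral_Ioi_sub_Ioi hint hs, sub_sub_cancel,
    ← integral_Ioi_comp_add_right f s]
  refine setIntegral_congr_fun measurableSet_Ioi fun r hr => ?_
  have hr0 : 0 ≤ r := (mem_Ioi.1 hr).le
  have h2 : T s.toNNReal (T r.toNNReal x) = T (r + s).toNNReal x := by
    rw [← ContinuousLinearMap.comp_apply, h.map_add, ← Real.toNNReal_add hs hr0, add_comm]
  simp only [hf, ContinuousLinearMap.comp_apply, h2, smul_smul, ← Real.exp_add]
  congr 2
  ring

theorem hasDerivAt_integral_orbit (h : IsWeakSemigroup F T C ω) (lam : ℝ)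
    {η : StrongDual ℂ A} (hη : η ∈ Submodule.span ℂ F) (x : A) (s : ℝ) :
    HasDerivAt (fun s => ∫ r in (0 : ℝ)..s, Real.exp (-lam * r) • η (T r.toNNReal x))
      (Real.exp (-lam * s) • η (T s.toNNReal x)) s := by
  have hc : Continuous fun r : ℝ => Real.exp (-lam * r) • η (T r.toNNReal x) :=
    (by fun_prop : Continuous fun r : ℝ => Real.exp (-lam * r)).smul (h.continuous_orbit hη x)
  exact hc.integral_hasStrictDerivAt 0 s |>.hasDerivAt

variable {L : A →ₗ.[ℂ] A}

/-- The Laplace transform maps into the domain of the generator. -/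
theorem laplace_mem_graph (h : IsWeakSemigroup F T C ω) (hL : IsGenerator F T L) {lam : ℝ}
    (hlam : ω < lam) (x : A) :
    (h.laplace lam x, (lam : ℂ) • h.laplace lam x - x) ∈ L.graph := by
  rw [hL, tendsto_nhds_sigmaTopology]
  intro η hη'
  have hη : η ∈ Submodule.span ℂ F := Submodule.subset_span hη'
  set R := h.laplace lam
  let G : ℝ → ℂ := fun s => Real.exp (lam * s) •
    (η (R x) - ∫ r in (0 : ℝ)..s, Real.exp (-lam * r) • η (T r.toNNReal x))
  have hG0 : G 0 = η (R x) := by simp [G]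
  have hG : ∀ s, 0 ≤ s → η (T s.toNNReal (R x)) = G s := fun s hs => by
    simp only [G, R]
    rw [← h.exp_smul_apply_laplace hlam hη x hs, smul_smul, ← Real.exp_add]
    simp
  have hder : HasDerivAt G (η ((lam : ℂ) • R x - x)) 0 := by
    have h1 : HasDerivAt (fun s : ℝ => Real.exp (lam * s)) (Real.exp (lam * 0) * (lam * 1)) 0 :=
      ((hasDerivAt_id (0 : ℝ)).const_mul lam).exp
    have h2 := (h.hasDerivAt_integral_orbit lam hη x 0).const_sub (η (R x))
    have h3 : HasDerivAt G _ 0 := h1.smul h2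
    refine h3.congr_deriv ?_
    simp [h.map_zero]
    ring
  have hslope := (hasDerivWithinAt_iff_tendsto_slope' self_notMem_Ioi).1
    (hder.hasDerivWithinAt (s := Ioi 0))
  refine (hslope.comp NNReal.tendsto_coe_nhdsGT_zero).congr fun t => ?_
  rw [Function.comp_apply, slope_def_module, ← hG t t.2, hG0, Real.toNNReal_coe, sub_zero, map_smul,
    map_sub, ← Complex.ofReal_inv, Complex.coe_smul]

/-- The Laplace transform is a left inverse of `lam - L`: for `x ∈ D(L)` the function
`e^{-lam t} η(T_t x)` has right derivative `e^{-lam t} η(T_t (L x - lam x))`. -/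
theorem laplace_apply_of_mem_graph [StarOrderedRing A] (h : IsWeakSemigroup F T C ω)
    (hL : IsGenerator F T L) {lam : ℝ} (hlam : ω < lam) {x y : A} (hxy : (x, y) ∈ L.graph) :
    h.laplace lam ((lam : ℂ) • x - y) = x := by
  refine h.ext_of_forall_apply_eq fun η hη' => ?_
  have hη : η ∈ Submodule.span ℂ F := Submodule.subset_span hη'
  rw [hL, tendsto_nhds_sigmaTopology] at hxy
  have hspan : ∀ θ ∈ Submodule.span ℂ F,
      Tendsto (fun t : ℝ≥0 => θ (((t : ℝ) : ℂ)⁻¹ • (T t x - x))) (𝓝[>] 0) (𝓝 (θ y)) := by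
    intro θ hθ
    induction hθ using Submodule.span_induction with
    | mem θ hθ => exact hxy θ hθ
    | zero => exact tendsto_const_nhds
    | add θ₁ θ₂ _ _ h₁ h₂ => exact h₁.add h₂
    | smul c θ _ h₁ => exact h₁.const_smul c
  set f : ℝ → ℂ := fun t => η (T t.toNNReal x) with hf
  have hfc : Continuous f := h.continuous_orbit hη x
  have hright : ∀ t, 0 ≤ t → HasDerivWithinAt f (η (T t.toNNReal y)) (Ioi t) t := by
    intro t ht
    rw [hasDerivWithinAt_iff_tendsto_slope' (by simp)]
    have h1 := (hspan _ (h.comp_mem hη t.toNNReal)).comp Real.tendsto_toNNReal_nhdsGT_zero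
    have h2 : Tendsto (fun s : ℝ => s - t) (𝓝[>] t) (𝓝[>] 0) := by
      refine tendsto_nhdsWithin_iff.2 ⟨?_, ?_⟩
      · exact ((continuous_id.sub continuous_const).tendsto' t 0 (sub_self t)).mono_left
          nhdsWithin_le_nhds
      · filter_upwards [self_mem_nhdsWithin] with s hs using by simpa using hs
    refine (h1.comp h2).congr' ?_
    filter_upwards [self_mem_nhdsWithin] with s hs
    have hst : 0 ≤ s - t := (sub_pos.2 (mem_Ioi.1 hs)).le
    have h3 : T t.toNNReal (T (s - t).toNNReal x) = T s.toNNReal x := by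
      rw [← ContinuousLinearMap.comp_apply, h.map_add, ← Real.toNNReal_add ht hst,
        add_sub_cancel]
    rw [slope_def_module, Function.comp_apply, Function.comp_apply, Real.coe_toNNReal _ hst,
      map_smul, map_sub,
      ContinuousLinearMap.comp_apply, ContinuousLinearMap.comp_apply, h3, ← Complex.ofReal_inv,
      Complex.coe_smul]
  set g : ℝ → ℂ := fun t => Real.exp (-lam * t) • η (T t.toNNReal ((lam : ℂ) • x - y)) with hg
  have hgc : Continuous g := (by fun_prop : Continuous fun r : ℝ => Real.exp (-lam * r)).smul
    (h.continuous_orbit hη _)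
  have hgi : IntegrableOn g (Ioi 0) :=
    integrableOn_exp_smul (h.continuous_orbit hη _) (h.norm_orbit_le η _) hlam
  have hFTC : ∀ b, 0 ≤ b → ∫ t in (0 : ℝ)..b, g t = η x - Real.exp (-lam * b) • f b := by
    intro b hb
    have h1 : ContinuousOn (fun t => -(Real.exp (-lam * t) • f t)) (uIcc 0 b) := by fun_prop
    rw [intervalIntegral.integral_eq_sub_of_hasDeriv_right h1 (fun t ht => ?_)
      (hgc.intervalIntegrable _ _)]
    · simp [hf, h.map_zero]
      ring
    · rw [min_eq_left hb] at ht
      have h2 : HasDerivAt (fun s : ℝ => Real.exp (-lam * s)) (Real.exp (-lam * t) * (-lam * 1)) t :=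
        ((hasDerivAt_id t).const_mul (-lam)).exp
      have h3 : HasDerivWithinAt (fun t => -(Real.exp (-lam * t) • f t)) _ (Ioi t) t :=
        (h2.hasDerivWithinAt.smul (hright t ht.1.le)).neg
      refine h3.congr_deriv ?_
      simp [hg, hf]
      ring
  have hlim1 := intervalIntegral_tendsto_integral_Ioi 0 hgi tendsto_id
  have hlim2 : Tendsto (fun b : ℝ => η x - Real.exp (-lam * b) • f b) atTop (𝓝 (η x - 0)) := by
    have := tendsto_pow_mul_exp_smul (h.norm_orbit_le η x) hlam 0
    simp only [pow_zero, one_mul] at this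
    exact tendsto_const_nhds.sub this
  rw [h.apply_laplace hlam hη, ← sub_zero (η x)]
  refine tendsto_nhds_unique hlim1 (hlim2.congr' ?_)
  filter_upwards [eventually_ge_atTop 0] with b hb using (hFTC b hb).symm

theorem isResolvent_laplace [StarOrderedRing A] (h : IsWeakSemigroup F T C ω)
    (hL : IsGenerator F T L) {lam : ℝ} (hlam : ω < lam) : IsResolvent L lam (h.laplace lam) := by
  refine ⟨fun x => ?_, fun x => ?_⟩
  · have hg := h.laplace_mem_graph hL hlam x
    have hd := LinearPMap.mem_domain_of_mem_graph hg
    exact ⟨hd, by rw [← (LinearPMap.image_iff hd).2 hg, sub_sub_cancel]⟩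
  · exact h.laplace_apply_of_mem_graph hL hlam (L.mem_graph x)

theorem isSymmetricMap_laplace [StarOrderedRing A] (h : IsWeakSemigroup F T C ω)
    (hs : ∀ t, IsSymmetricMap (T t)) {lam : ℝ} (hlam : ω < lam) :
    IsSymmetricMap (h.laplace lam) := by
  intro x
  refine h.ext_of_forall_apply_eq fun η hη => ?_
  obtain ⟨θ, hθ, hθη⟩ := h.exists_star η hη
  have h1 : η (star (h.laplace lam x)) = star (θ (h.laplace lam x)) := by rw [hθη, star_star]
  rw [h1, h.apply_laplace hlam (Submodule.subset_span hη),
    h.apply_laplace hlam (Submodule.subset_span hθ), Complex.star_def, ← integral_conj]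
  refine integral_congr_ae (Eventually.of_forall fun t => ?_)
  simp only [hθη, hs _ x, Complex.real_smul, map_mul, Complex.conj_ofReal, Complex.star_def,
    Complex.conj_conj]

/-- An operator inequality between `T_t (c₁)`, `a T_t (1) b`, `T_t (c₂) b` and `a T_t (c₃)` that
holds for all `t` is inherited by the Laplace transform. -/
theorem laplace_le_of_forall_le [StarOrderedRing A] (h : IsWeakSemigroup F T C ω) {lam : ℝ}
    (hlam : ω < lam) (c₁ c₂ c₃ a b : A)
    (hT : ∀ t, T t c₂ * b + a * T t c₃ ≤ T t c₁ + a * T t 1 * b) :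
    h.laplace lam c₂ * b + a * h.laplace lam c₃ ≤ h.laplace lam c₁ + a * h.laplace lam 1 * b := by
  rw [← sub_nonneg]
  refine h.nonneg _ fun η hη hpos => ?_
  obtain ⟨θ₁, hθ₁, e₁⟩ := h.exists_mul η hη a b
  obtain ⟨θ₂, hθ₂, e₂⟩ := h.exists_mul η hη 1 b
  obtain ⟨θ₃, hθ₃, e₃⟩ := h.exists_mul η hη a 1
  simp only [one_mul, mul_one] at e₂ e₃
  have hi : ∀ θ ∈ F, ∀ x, IntegrableOn (fun t : ℝ => Real.exp (-lam * t) • θ (T t.toNNReal x))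
      (Ioi 0) := fun θ hθ x => integrableOn_exp_smul
    (h.continuous_orbit (Submodule.subset_span hθ) x) (h.norm_orbit_le θ x) hlam
  have key : η (h.laplace lam c₁ + a * h.laplace lam 1 * b -
      (h.laplace lam c₂ * b + a * h.laplace lam c₃)) = ∫ t in Ioi (0 : ℝ), Real.exp (-lam * t) •
        η (T t.toNNReal c₁ + a * T t.toNNReal 1 * b -
          (T t.toNNReal c₂ * b + a * T t.toNNReal c₃)) := by
    simp only [map_sub, map_add, ← e₁, ← e₂, ← e₃, smul_sub, smul_add]
    rw [integral_sub, integral_add (hi η hη _) (hi θ₁ hθ₁ _),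
      integral_add (hi θ₂ hθ₂ _) (hi θ₃ hθ₃ _)]
    rotate_left
    · exact (hi η hη _).add (hi θ₁ hθ₁ _)
    · exact (hi θ₂ hθ₂ _).add (hi θ₃ hθ₃ _)
    simp only [h.apply_laplace hlam (Submodule.subset_span hη),
      h.apply_laplace hlam (Submodule.subset_span hθ₁),
      h.apply_laplace hlam (Submodule.subset_span hθ₂),
      h.apply_laplace hlam (Submodule.subset_span hθ₃)]
  -- Without integrability the integral is `0`, and the claim is trivial.
  by_cases hint : IntegrableOn (fun t : ℝ => Real.exp (-lam * t) •
        η (T t.toNNReal c₁ + a * T t.toNNReal 1 * b -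
          (T t.toNNReal c₂ * b + a * T t.toNNReal c₃))) (Ioi 0)
  · rw [key, ← RCLike.re_eq_complex_re, ← integral_re hint]
    refine integral_nonneg fun t => ?_
    simp only [RCLike.re_eq_complex_re, Complex.smul_re]
    exact smul_nonneg (Real.exp_pos _).le (hpos _ (sub_nonneg.2 (hT _)))
  · rw [key, integral_undef hint, Complex.zero_re]

/-- `k! η(R^{k+1} y) = ∫_0^∞ r^k e^{-lam r} η(T_r y) dr`, by integration by parts. -/
theorem integral_pow_mul_exp_smul (h : IsWeakSemigroup F T C ω) {lam : ℝ} (hlam : ω < lam)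
    {η : StrongDual ℂ A} (hη : η ∈ Submodule.span ℂ F) (k : ℕ) (y : A) :
    ∫ r in Ioi (0 : ℝ), (r ^ k * Real.exp (-lam * r)) • η (T r.toNNReal y) =
      (k.factorial : ℝ) • η ((h.laplace lam ^ (k + 1)) y) := by
  induction k generalizing y with
  | zero => simp [h.apply_laplace hlam hη]
  | succ k ih =>
    set R := h.laplace lam with hR
    have hi : ∀ j z, IntegrableOn
        (fun r : ℝ => (r ^ j * Real.exp (-lam * r)) • η (T r.toNNReal z)) (Ioi 0) := fun j z =>
      integrableOn_pow_mul_exp_smul (h.continuous_orbit hη z) (h.norm_orbit_le η z) hlam j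
    let H : ℝ → ℂ := fun s => η (R y) - ∫ r in (0 : ℝ)..s, Real.exp (-lam * r) • η (T r.toNNReal y)
    have hH : ∀ s, 0 ≤ s → Real.exp (-lam * s) • η (T s.toNNReal (R y)) = H s := fun s hs =>
      h.exp_smul_apply_laplace hlam hη y hs
    have hder : ∀ s, HasDerivAt (fun s : ℝ => s ^ (k + 1) • H s)
        (s ^ (k + 1) • -(Real.exp (-lam * s) • η (T s.toNNReal y)) +
          (((k + 1 : ℕ) : ℝ) * s ^ k) • H s) s := fun s => by
      have h1 : HasDerivAt (fun s : ℝ => s ^ (k + 1)) (((k + 1 : ℕ) : ℝ) * s ^ k) s := by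
        simpa using hasDerivAt_pow (k + 1) s
      have h2 := (h.hasDerivAt_integral_orbit lam hη y s).const_sub (η (R y))
      exact h1.smul h2
    have hcongr : EqOn (fun s : ℝ => s ^ (k + 1) • -(Real.exp (-lam * s) • η (T s.toNNReal y)) +
          (((k + 1 : ℕ) : ℝ) * s ^ k) • H s) (fun s => ((k + 1 : ℕ) : ℝ) •
            ((s ^ k * Real.exp (-lam * s)) • η (T s.toNNReal (R y))) -
            (s ^ (k + 1) * Real.exp (-lam * s)) • η (T s.toNNReal y)) (Ioi 0) := fun s hs => by
      simp only [← hH s (mem_Ioi.1 hs).le, smul_neg, smul_smul]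
      rw [neg_add_eq_sub, mul_assoc]
    have hlim : Tendsto (fun s : ℝ => s ^ (k + 1) • H s) atTop (𝓝 0) := by
      refine (tendsto_pow_mul_exp_smul (h.norm_orbit_le η (R y)) hlam (k + 1)).congr' ?_
      filter_upwards [eventually_ge_atTop 0] with s hs
      rw [← hH s hs, smul_smul]
    have hk : IntegrableOn (fun s : ℝ => ((k + 1 : ℕ) : ℝ) •
        ((s ^ k * Real.exp (-lam * s)) • η (T s.toNNReal (R y)))) (Ioi 0) :=
      Integrable.smul (((k + 1 : ℕ) : ℝ)) (hi k (R y))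
    have hdiff : IntegrableOn (fun s : ℝ => ((k + 1 : ℕ) : ℝ) •
        ((s ^ k * Real.exp (-lam * s)) • η (T s.toNNReal (R y))) -
          (s ^ (k + 1) * Real.exp (-lam * s)) • η (T s.toNNReal y)) (Ioi 0) := hk.sub (hi (k + 1) y)
    have h1 := integral_Ioi_of_hasDerivAt_of_tendsto (hder 0).continuousAt.continuousWithinAt
      (fun s _ => hder s)
      (hdiff.congr_fun hcongr.symm measurableSet_Ioi) hlim
    rw [setIntegral_congr_fun measurableSet_Ioi hcongr, integral_sub hk (hi (k + 1) y),
      integral_smul, ih] at h1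
    rw [zero_pow (Nat.succ_ne_zero k), zero_smul, sub_zero, sub_eq_zero] at h1
    rw [← h1, Nat.factorial_succ, Nat.cast_mul, smul_smul, pow_succ (n := k + 1)]
    rfl

/-- Positivity of the resolvents near infinity gives positivity of the semigroup. -/
theorem isPositiveMap_of_laplace [StarOrderedRing A] (h : IsWeakSemigroup F T C ω) {lam₀ : ℝ}
    (hlam₀ : ω < lam₀) (hR : ∀ lam, lam₀ ≤ lam → IsPositiveMap (h.laplace lam)) (t : ℝ≥0) :
    IsPositiveMap (T t) := by
  intro x hx
  rcases eq_or_ne t 0 with rfl | ht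
  · rwa [h.map_zero]
  refine h.nonneg _ fun η hη' hpos => ?_
  have hη : η ∈ Submodule.span ℂ F := Submodule.subset_span hη'
  have hc : Continuous fun r : ℝ => (η (T r.toNNReal x)).re :=
    Complex.continuous_re.comp (h.continuous_orbit hη x)
  have := nonneg_of_forall_integral_pow_mul_exp_nonneg hc (C := ‖η‖ * C * ‖x‖) (ω := ω)
    (fun r hr => (Complex.abs_re_le_norm _).trans (h.norm_orbit_le η x r hr)) hlam₀
    (fun lam hlam k => ?_) (NNReal.coe_pos.2 (pos_iff_ne_zero.2 ht))
  · simpa using this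
  · have hlam' : ω < lam := hlam₀.trans_le hlam
    have hi := integrableOn_pow_mul_exp_smul (h.continuous_orbit hη x) (h.norm_orbit_le η x) hlam' k
    have h1 := congrArg Complex.re (h.integral_pow_mul_exp_smul hlam' hη k x)
    rw [← RCLike.re_eq_complex_re, ← integral_re hi] at h1
    simp only [RCLike.re_eq_complex_re, Complex.smul_re, smul_eq_mul] at h1
    rw [h1]
    exact mul_nonneg (Nat.cast_nonneg _) (hpos _ ((hR lam hlam).pow (k + 1) x hx))

/-- The equivalence of the positivity conditions for a semigroup in the weak framework. -/
theorem tfae [StarOrderedRing A] (h : IsWeakSemigroup F T C ω)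
    (hs : ∀ t, IsSymmetricMap (T t)) (hL : IsGenerator F T L) :
    (∀ᶠ lam : ℝ in atTop, ∃ R, IsResolvent L lam R) ∧
    List.TFAE [
      ∀ t, IsPositiveMap (T t),
      ∀ᶠ lam : ℝ in atTop, ∃ R, IsResolvent L lam R ∧ IsPositiveMap R,
      ∀ᶠ lam : ℝ in atTop, ∃ R, IsResolvent L lam R ∧ SelfAdjointInequality R,
      ∀ᶠ lam : ℝ in atTop, ∃ R, IsResolvent L lam R ∧ UnitaryInequality R,
      ∀ t, SelfAdjointInequality (T t),
      ∀ t, UnitaryInequality (T t)] := by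
  have hres : ∀ᶠ lam : ℝ in atTop, ω < lam := eventually_gt_atTop ω
  have hiff : ∀ P : (A →L[ℂ] A) → Prop, (∀ᶠ lam : ℝ in atTop, ∃ R, IsResolvent L lam R ∧ P R) →
      ∃ lam₀, ω < lam₀ ∧ ∀ lam, lam₀ ≤ lam → P (h.laplace lam) := by
    intro P hP
    obtain ⟨lam₀, h₀⟩ := eventually_atTop.1 (hP.and hres)
    refine ⟨lam₀, (h₀ lam₀ le_rfl).2, fun lam hlam => ?_⟩
    obtain ⟨⟨R, hR, hPR⟩, hω⟩ := h₀ lam hlam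
    rwa [(h.isResolvent_laplace hL hω).unique hR]
  refine ⟨hres.mono fun lam hlam => ⟨_, h.isResolvent_laplace hL hlam⟩, ?_⟩
  tfae_have 1 → 5 := fun hT t => (hT t).selfAdjointInequality
  tfae_have 1 → 6 := fun hT t => (hT t).unitaryInequality
  tfae_have 2 → 4 := fun hR => hR.mono fun lam ⟨R, h1, h2⟩ => ⟨R, h1, h2.unitaryInequality⟩
  tfae_have 4 → 3 := fun hR => hR.mono fun lam ⟨R, h1, h2⟩ => ⟨R, h1, h2.selfAdjointInequality⟩
  tfae_have 5 → 3 := fun hT => hres.mono fun lam hlam => ⟨_, h.isResolvent_laplace hL hlam,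
    fun a ha => h.laplace_le_of_forall_le hlam _ _ _ _ _ fun t => hT t a ha⟩
  tfae_have 6 → 4 := fun hT => hres.mono fun lam hlam => ⟨_, h.isResolvent_laplace hL hlam,
    fun u hu => h.laplace_le_of_forall_le hlam _ _ _ _ _ fun t => hT t u hu⟩
  tfae_have 3 → 2 := fun hR => by
    obtain ⟨lam₀, hω, hS⟩ := hiff _ hR
    filter_upwards [eventually_gt_atTop lam₀] with lam hlam
    exact ⟨_, h.isResolvent_laplace hL (hω.trans hlam),
      isPositiveMap_of_forall_selfAdjointInequality
        (fun μ hμ => h.isResolvent_laplace hL (hω.trans hμ))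
        (fun μ hμ => h.isSymmetricMap_laplace hs (hω.trans hμ)) (fun μ hμ => hS μ hμ.le) hlam⟩
  tfae_have 2 → 1 := fun hR => by
    obtain ⟨lam₀, hω, hS⟩ := hiff _ hR
    exact h.isPositiveMap_of_laplace hω hS
  tfae_finish

end IsWeakSemigroup

end WeakSemigroup

/-! ### Strongly continuous semigroups -/

section ExponentialBound

variable {A : Type*} [NormedRing A] [NormedAlgebra ℂ A] {T : ℝ≥0 → A →L[ℂ] A}

theorem IsOperatorSemigroup.apply_apply (hT : IsOperatorSemigroup T) (t s : ℝ≥0) (x : A) :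
    T t (T s x) = T (t + s) x := by
  rw [← ContinuousLinearMap.comp_apply, hT.map_add]

/-- A semigroup that is bounded near `0` is exponentially bounded. -/
theorem IsOperatorSemigroup.exists_norm_le_exp (hT : IsOperatorSemigroup T) {δ : ℝ≥0} (hδ : 0 < δ)
    {K : ℝ} (hK : ∀ t ≤ δ, ‖T t‖ ≤ K) : ∃ C ω : ℝ, ∀ t, ‖T t‖ ≤ C * Real.exp (ω * t) := by
  set K' : ℝ := max K 1 with hK'
  have h1 : 1 ≤ K' := le_max_right _ _
  have hpow : ∀ (n : ℕ) (t : ℝ≥0), t ≤ (n + 1) * δ → ‖T t‖ ≤ K' ^ (n + 1) := by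
    intro n
    induction n with
    | zero =>
      intro t ht
      rw [zero_add, pow_one]
      exact (hK t (by simpa using ht)).trans (le_max_left _ _)
    | succ n ih =>
      intro t ht
      rcases le_total t δ with htδ | htδ
      · exact ((hK t htδ).trans (le_max_left _ _)).trans (le_self_pow₀ h1 (Nat.succ_ne_zero _))
      · have e : T t = T δ ∘L T (t - δ) := by rw [hT.map_add, add_tsub_cancel_of_le htδ]
        have h2 : t - δ ≤ (n + 1) * δ := by
          rw [tsub_le_iff_right]
          refine ht.trans_eq ?_
          push_cast
          ring
        rw [e, pow_succ' K']
        exact (ContinuousLinearMap.opNorm_comp_le _ _).trans (mul_le_mul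
          ((hK δ le_rfl).trans (le_max_left _ _)) (ih _ h2) (norm_nonneg _) (by linarith))
  refine ⟨K', Real.log K' / δ, fun t => ?_⟩
  have hδ' : (0 : ℝ) < δ := hδ
  have hn := hpow ⌊(t : ℝ) / δ⌋₊ t (by
    rw [← NNReal.coe_le_coe]
    push_cast
    rw [← div_le_iff₀ hδ']
    exact (Nat.lt_floor_add_one _).le)
  refine hn.trans ?_
  rw [pow_succ', ← Real.exp_log (pow_pos (zero_lt_one.trans_le h1) _), Real.log_pow]
  refine mul_le_mul_of_nonneg_left (Real.exp_le_exp.2 ?_) (by linarith)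
  calc (⌊(t : ℝ) / δ⌋₊ : ℝ) * Real.log K' ≤ t / δ * Real.log K' :=
        mul_le_mul_of_nonneg_right (Nat.floor_le (by positivity)) (Real.log_nonneg h1)
    _ = _ := by ring

theorem IsC0Semigroup.tendsto_nhds_zero (hT : IsC0Semigroup T) (x : A) :
    Tendsto (fun t => T t x) (𝓝 0) (𝓝 x) := by
  have h1 : Tendsto (fun t => T t x) (𝓝[>] 0) (𝓝 x) :=
    tendsto_iff_norm_sub_tendsto_zero.2 (hT.tendsto_zero x)
  have h2 : Tendsto (fun t => T t x) (pure 0) (𝓝 x) :=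
    (tendsto_pure_nhds (fun t => T t x) (0 : ℝ≥0)).trans_eq (by simp [hT.map_zero])
  have h3 : 𝓝 (0 : ℝ≥0) = pure 0 ⊔ 𝓝[>] 0 := by
    have hu : ({0} ∪ Set.Ioi 0 : Set ℝ≥0) = Set.univ :=
      Set.eq_univ_of_forall fun t => (eq_or_ne t 0).imp id pos_iff_ne_zero.2
    rw [← nhdsWithin_singleton, ← nhdsWithin_union, hu, nhdsWithin_univ]
  rw [h3]
  exact h2.sup h1

/-- Strongly continuous semigroups are bounded near `0`, by the uniform boundedness principle, hence
exponentially bounded. -/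
theorem IsC0Semigroup.exists_norm_le_exp [CompleteSpace A] (hT : IsC0Semigroup T) :
    ∃ C ω : ℝ, ∀ t, ‖T t‖ ≤ C * Real.exp (ω * t) := by
  obtain ⟨n, hn⟩ : ∃ n : ℕ, ∀ t ≤ ((n : ℝ≥0) + 1)⁻¹, ‖T t‖ ≤ n := by
    by_contra! hcon
    choose t ht hlt using hcon
    have ht0 : Tendsto t atTop (𝓝 0) :=
      tendsto_of_tendsto_of_tendsto_of_le_of_le tendsto_const_nhds
        (by simpa [one_div] using tendsto_one_div_add_atTop_nhds_zero_nat (𝕜 := ℝ≥0)) (fun _ => bot_le) ht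
    obtain ⟨K, hK⟩ := banach_steinhaus (g := fun n => T (t n)) fun x => by
      obtain ⟨K, hK⟩ := ((hT.tendsto_nhds_zero x).comp ht0).norm.bddAbove_range
      exact ⟨K, fun n => hK ⟨n, rfl⟩⟩
    obtain ⟨n, hn⟩ := exists_nat_gt K
    exact (hn.trans (hlt n)).not_ge (hK n)
  exact hT.toIsOperatorSemigroup.exists_norm_le_exp (by positivity) hn

theorem IsC0Semigroup.continuous_orbit [CompleteSpace A] (hT : IsC0Semigroup T) (x : A) :
    Continuous fun t => T t x := by
  obtain ⟨C, ω, hC⟩ := hT.exists_norm_le_exp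
  have hC0 : 0 ≤ C := by simpa using (norm_nonneg _).trans (hC 0)
  refine continuous_iff_continuousAt.2 fun t₀ => tendsto_iff_norm_sub_tendsto_zero.2 ?_
  -- With `m = min t t₀`, the difference is, up to sign, `T_m (T_{|t - t₀|} x - x)`.
  have hle : ∀ t : ℝ≥0, ‖T t x - T t₀ x‖ ≤ C * Real.exp (|ω| * t₀) * ‖T (nndist t t₀) x - x‖ := by
    intro t
    have hmin : ‖T (min t t₀)‖ ≤ C * Real.exp (|ω| * t₀) := by
      refine (hC _).trans (mul_le_mul_of_nonneg_left (Real.exp_le_exp.2 ?_) hC0)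
      have h1 : ((min t t₀ : ℝ≥0) : ℝ) ≤ t₀ := by exact_mod_cast min_le_right t t₀
      exact (mul_le_mul_of_nonneg_right (le_abs_self ω) (NNReal.coe_nonneg _)).trans
        (mul_le_mul_of_nonneg_left h1 (abs_nonneg ω))
    have hdiff : ‖T t x - T t₀ x‖ = ‖T (min t t₀) (T (nndist t t₀) x - x)‖ := by
      rw [map_sub, hT.apply_apply]
      rcases le_total t t₀ with h | h
      · rw [min_eq_left h, NNReal.nndist_eq, tsub_eq_zero_of_le h, max_eq_right zero_le,
          add_tsub_cancel_of_le h, norm_sub_rev]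
      · rw [min_eq_right h, NNReal.nndist_eq, tsub_eq_zero_of_le h, max_eq_left zero_le,
          add_tsub_cancel_of_le h]
    rw [hdiff]
    exact (T (min t t₀)).le_of_opNorm_le hmin _
  have hd : Tendsto (fun t => nndist t t₀) (𝓝 t₀) (𝓝 0) :=
    (continuous_id.nndist continuous_const).tendsto' _ _ (nndist_self _)
  have hlim := (tendsto_iff_norm_sub_tendsto_zero.1 ((hT.tendsto_nhds_zero x).comp hd)).const_mul
    (C * Real.exp (|ω| * t₀))
  rw [mul_zero] at hlim
  exact squeeze_zero (fun _ => norm_nonneg _) hle hlim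

end ExponentialBound

section DualActions

variable {A : Type*} [NormedRing A] [NormedAlgebra ℂ A]

theorem StrongDual.exists_mul_mul (η : StrongDual ℂ A) (a b : A) :
    ∃ θ : StrongDual ℂ A, ∀ x, θ x = η (a * x * b) :=
  ⟨η ∘L ((ContinuousLinearMap.mul ℂ A).flip b) ∘L (ContinuousLinearMap.mul ℂ A a), fun _ => rfl⟩

theorem StrongDual.exists_star_star [StarRing A] [NormedStarGroup A] [StarModule ℂ A]
    (η : StrongDual ℂ A) : ∃ θ : StrongDual ℂ A, ∀ x, θ x = star (η (star x)) :=
  ⟨((starL ℂ : ℂ ≃L⋆[ℂ] ℂ) : ℂ →L⋆[ℂ] ℂ).comp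
    (η.comp ((starL ℂ : A ≃L⋆[ℂ] A) : A →L⋆[ℂ] A)), fun _ => rfl⟩

end DualActions

section StronglyContinuous

open MeasureTheory Set

variable {A : Type*} [CStarAlgebra A] [PartialOrder A] [StarOrderedRing A]

/-- The positive cone is determined by the functionals that are nonnegative on it, by Hahn–Banach
separation. -/
theorem nonneg_of_forall_strongDual {x : A}
    (hx : ∀ η : StrongDual ℂ A, (∀ a, 0 ≤ a → 0 ≤ (η a).re) → 0 ≤ (η x).re) : 0 ≤ x := by
  by_contra hneg
  obtain ⟨f, hf, hfx⟩ := ProperCone.hyperplane_separation_point (ProperCone.positive ℝ A)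
    (x₀ := x) (by simpa using hneg)
  have hre : ∀ a, ((StrongDual.extendRCLike (𝕜 := ℂ) f) a).re = f a := fun a => by
    simp [StrongDual.extendRCLike_apply]
  have := hx (StrongDual.extendRCLike (𝕜 := ℂ) f) fun a ha => by
    rw [hre]; exact hf a (by simpa using ha)
  rw [hre] at this
  exact hfx.not_ge this

/-- For strongly continuous semigroups the Laplace transforms are Bochner integrals. -/
theorem IsC0Semigroup.isWeakSemigroup {T : ℝ≥0 → A →L[ℂ] A} (hT : IsC0Semigroup T) :
    ∃ C ω, IsWeakSemigroup Set.univ T C ω := by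
  obtain ⟨C, ω, hC⟩ := hT.exists_norm_le_exp
  refine ⟨C, ω, { toIsOperatorSemigroup := hT.toIsOperatorSemigroup
                  norm_le := hC
                  continuous_time := fun η _ x => η.continuous.comp (hT.continuous_orbit x)
                  comp_mem_span := fun η _ t => Submodule.subset_span (mem_univ _)
                  exists_mul := fun η _ a b => by simpa using η.exists_mul_mul a b
                  exists_star := fun η _ => by simpa using η.exists_star_star
                  nonneg := fun x hx => nonneg_of_forall_strongDual fun η => hx η (mem_univ _)
                  exists_laplace := fun lam hlam => ?_ }⟩
  have hc : ∀ x, Continuous fun t : ℝ => T t.toNNReal x := fun x =>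
    (hT.continuous_orbit x).comp continuous_real_toNNReal
  have hb : ∀ x (r : ℝ), 0 ≤ r → ‖T r.toNNReal x‖ ≤ C * ‖x‖ * Real.exp (ω * r) := fun x r hr => by
    have h1 := (T r.toNNReal).le_of_opNorm_le (hC r.toNNReal) x
    rw [Real.coe_toNNReal r hr] at h1
    linarith
  have hi : ∀ x, IntegrableOn (fun t : ℝ => Real.exp (-lam * t) • T t.toNNReal x) (Ioi 0) :=
    fun x => integrableOn_exp_smul (hc x) (hb x) hlam
  have hD : IntegrableOn (fun t : ℝ => Real.exp (-lam * t) • (C * Real.exp (ω * t))) (Ioi 0) :=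
    integrableOn_exp_smul (by fun_prop) (C := |C|) (ω := ω)
      (fun r _ => by rw [norm_mul, Real.norm_of_nonneg (Real.exp_pos _).le, Real.norm_eq_abs]) hlam
  let R : A →ₗ[ℂ] A :=
    { toFun := fun x => ∫ t in Ioi (0 : ℝ), Real.exp (-lam * t) • T t.toNNReal x
      map_add' := fun x y => by
        simp only [map_add, smul_add]
        exact integral_add (hi x) (hi y)
      map_smul' := fun c x => by
        simp only [map_smul, smul_comm _ c]
        exact integral_smul c _ }
  refine ⟨R.mkContinuous (∫ t in Ioi (0 : ℝ), Real.exp (-lam * t) • (C * Real.exp (ω * t)))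
    fun x => ?_, fun η _ x => ?_⟩
  · rw [← integral_mul_const]
    refine norm_integral_le_of_norm_le (hD.mul_const _) ?_
    filter_upwards [ae_restrict_mem measurableSet_Ioi] with t ht
    rw [norm_smul, Real.norm_of_nonneg (Real.exp_pos _).le, smul_eq_mul, mul_assoc]
    refine mul_le_mul_of_nonneg_left ((hb x t (mem_Ioi.1 ht).le).trans_eq ?_) (Real.exp_pos _).le
    ring
  · change η (∫ t in Ioi (0 : ℝ), Real.exp (-lam * t) • T t.toNNReal x) = _
    rw [← ContinuousLinearMap.integral_comp_comm η (hi x)]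
    simp only [← Complex.coe_smul, map_smul]

end StronglyContinuous

/-! ### Von Neumann algebras and their preduals -/

namespace VonNeumannAlgebra

open MeasureTheory Set

variable {H : Type*} [NormedAddCommGroup H] [InnerProductSpace ℂ H] [CompleteSpace H]

theorem isClosed_toStarSubalgebra (M : VonNeumannAlgebra H) :
    IsClosed (M.toStarSubalgebra : Set (H →L[ℂ] H)) := by
  rw [VonNeumannAlgebra.coe_toStarSubalgebra, ← M.centralizer_centralizer]
  exact Set.isClosed_centralizer _

/-- The Loewner order restricted to a von Neumann algebra is its C*-algebra order, because square
roots of positive elements stay in the algebra. -/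
theorem starOrderedRing (M : VonNeumannAlgebra H) : StarOrderedRing M.toStarSubalgebra := by
  have hcl := M.isClosed_toStarSubalgebra
  refine StarOrderedRing.of_nonneg_iff' (fun {x y} hxy z => ?_) fun x => ⟨fun hx => ?_, ?_⟩
  · exact add_le_add_right (α := H →L[ℂ] H) hxy z
  · have hx' : (0 : H →L[ℂ] H) ≤ x := hx
    have hsa : IsSelfAdjoint x := Subtype.ext (IsSelfAdjoint.of_nonneg hx').star_eq
    have hnn : ∀ r ∈ spectrum ℝ x, 0 ≤ r := by
      intro r hr
      rw [← spectrum.preimage_algebraMap (S := ℂ), Set.mem_preimage,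
        StarSubalgebra.spectrum_eq] at hr
      refine spectrum_nonneg_of_nonneg hx' ?_
      rwa [← spectrum.preimage_algebraMap (S := ℂ), Set.mem_preimage]
    refine ⟨cfc Real.sqrt x, ?_⟩
    rw [(cfc_predicate Real.sqrt x : IsSelfAdjoint _).star_eq, ← cfc_mul Real.sqrt Real.sqrt x]
    conv_lhs => rw [← cfc_id' ℝ x]
    exact cfc_congr fun r hr => (Real.mul_self_sqrt (hnn r hr)).symm
  · rintro ⟨s, rfl⟩
    exact star_mul_self_nonneg (s : H →L[ℂ] H)

variable {M : VonNeumannAlgebra H}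

theorem summable_norm_mul_norm {H : Type*} [NormedAddCommGroup H] {ξ ζ : ℕ → H} (hξ : Summable fun n => ‖ξ n‖ ^ 2)
    (hζ : Summable fun n => ‖ζ n‖ ^ 2) : Summable fun n => ‖ξ n‖ * ‖ζ n‖ :=
  .of_nonneg_of_le (fun _ => by positivity)
    (fun n => by nlinarith [sq_nonneg (‖ξ n‖ - ‖ζ n‖), sq_nonneg (‖ξ n‖), sq_nonneg (‖ζ n‖)])
    (hξ.add hζ)

/-- Vector functionals belong to the predual. -/
theorem exists_mem_predual_inner (M : VonNeumannAlgebra H) (ξ ζ : H) :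
    ∃ η ∈ M.predual, ∀ x : M.toStarSubalgebra, η x = ⟪ξ, (x : H →L[ℂ] H) ζ⟫_ℂ := by
  let ι : M.toStarSubalgebra →L[ℂ] (H →L[ℂ] H) :=
    LinearMap.mkContinuous { toFun := fun x => (x : H →L[ℂ] H)
                             map_add' := fun _ _ => rfl
                             map_smul' := fun _ _ => rfl } 1 fun x => by
      rw [one_mul]; exact le_rfl
  have hs : ∀ v : H, Summable fun n => ‖(Pi.single 0 v : ℕ → H) n‖ ^ 2 := fun v =>
    summable_of_ne_finset_zero (s := {0}) fun n hn => by
      rw [Pi.single_eq_of_ne (by simpa using hn)]; simp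
  refine ⟨innerSL ℂ ξ ∘L ContinuousLinearMap.apply ℂ H ζ ∘L ι, ⟨Pi.single 0 ξ, Pi.single 0 ζ,
    hs ξ, hs ζ, fun x => ?_⟩, fun x => rfl⟩
  convert hasSum_single (f := fun n => ⟪(Pi.single 0 ξ : ℕ → H) n,
    (x : H →L[ℂ] H) ((Pi.single 0 ζ : ℕ → H) n)⟫_ℂ) 0 (fun n hn => ?_) using 1
  · simp; rfl
  · simp [Pi.single_eq_of_ne hn]

theorem exists_mul_mem_predual {η : StrongDual ℂ M.toStarSubalgebra} (hη : η ∈ M.predual)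
    (a b : M.toStarSubalgebra) : ∃ θ ∈ M.predual, ∀ x, θ x = η (a * x * b) := by
  obtain ⟨θ, hθ⟩ := η.exists_mul_mul a b
  obtain ⟨ξ, ζ, hξ, hζ, hsum⟩ := hη
  have hbd : ∀ (c : H →L[ℂ] H) (v : ℕ → H), (Summable fun n => ‖v n‖ ^ 2) →
      Summable fun n => ‖c (v n)‖ ^ 2 := fun c v hv =>
    .of_nonneg_of_le (fun _ => by positivity)
      (fun n => by
        rw [← mul_pow]
        exact pow_le_pow_left₀ (norm_nonneg _) (c.le_opNorm _) 2) (hv.mul_left (‖c‖ ^ 2))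
  refine ⟨θ, ⟨fun n => ContinuousLinearMap.adjoint (a : H →L[ℂ] H) (ξ n),
    fun n => (b : H →L[ℂ] H) (ζ n), hbd _ _ hξ, hbd _ _ hζ, fun x => ?_⟩, hθ⟩
  rw [hθ]
  simpa [ContinuousLinearMap.adjoint_inner_left] using hsum (a * x * b)

theorem exists_star_mem_predual {η : StrongDual ℂ M.toStarSubalgebra} (hη : η ∈ M.predual) :
    ∃ θ ∈ M.predual, ∀ x, θ x = star (η (star x)) := by
  have hcl := M.isClosed_toStarSubalgebra
  obtain ⟨θ, hθ⟩ := η.exists_star_star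
  obtain ⟨ξ, ζ, hξ, hζ, hsum⟩ := hη
  refine ⟨θ, ⟨ζ, ξ, hζ, hξ, fun x => ?_⟩, hθ⟩
  rw [hθ]
  convert (hsum (star x)).star using 2 with n
  rw [StarMemClass.coe_star, ContinuousLinearMap.star_eq_adjoint,
    ContinuousLinearMap.adjoint_inner_right]
  exact (inner_conj_symm _ _).symm

/-- Positivity is detected by the functionals `⟪ξ, · (c ξ)⟫` with `Re c ≥ 0`; taking `c = ±i` shows
that the quadratic form is real. -/
theorem nonneg_of_forall_predual {x : M.toStarSubalgebra}
    (hx : ∀ η ∈ M.predual, (∀ a, 0 ≤ a → 0 ≤ (η a).re) → 0 ≤ (η x).re) : 0 ≤ x := by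
  change (0 : H →L[ℂ] H) ≤ x
  have key : ∀ (ξ : H) (c : ℂ), (0 ≤ c.re) → (0 ≤ (c * ⟪ξ, (x : H →L[ℂ] H) ξ⟫_ℂ).re) := by
    intro ξ c hc
    obtain ⟨η, hη, hηx⟩ := M.exists_mem_predual_inner ξ (c • ξ)
    have := hx η hη fun a ha => ?_
    · simpa [hηx, inner_smul_right] using this
    · have ha' : (0 : H →L[ℂ] H) ≤ a := ha
      have h1 := ((ContinuousLinearMap.nonneg_iff_isPositive _).1 ha').inner_nonneg_right ξ
      rw [hηx, map_smul, inner_smul_right]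
      obtain ⟨h2, h3⟩ := Complex.nonneg_iff.1 h1
      rw [Complex.mul_re, ← h3, mul_zero, sub_zero]
      exact mul_nonneg hc h2
  rw [ContinuousLinearMap.nonneg_iff_isPositive, ContinuousLinearMap.isPositive_iff_complex]
  intro ξ
  have h1 := key ξ 1 (by simp)
  have h2 := key ξ Complex.I (by simp)
  have h3 := key ξ (-Complex.I) (by simp)
  rw [one_mul] at h1
  simp at h2 h3
  have him : (⟪ξ, (x : H →L[ℂ] H) ξ⟫_ℂ).im = 0 := le_antisymm h2 h3
  rw [← inner_conj_symm, Complex.conj_eq_iff_im.2 him]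
  exact ⟨Complex.ext rfl him.symm, h1⟩

end VonNeumannAlgebra

/-- A functional that is continuous for `σ(A, F)` is a linear combination of elements of `F`. -/
theorem mem_span_of_continuous_sigmaTopology {A : Type*} [NormedRing A] [NormedAlgebra ℂ A]
    {F : Set (StrongDual ℂ A)} {θ : StrongDual ℂ A}
    (hθ : Continuous[sigmaTopology F, inferInstance] fun x => θ x) : θ ∈ Submodule.span ℂ F := by
  have h1 : (θ : A →ₗ[ℂ] ℂ) ∈ Submodule.span ℂ
      (Set.range fun η : F => ((η : StrongDual ℂ A) : A →ₗ[ℂ] ℂ)) := by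
    rw [LinearMap.mem_span_iff_continuous]
    convert hθ using 1
    · rw [sigmaTopology, iInf_subtype']
      rfl
    · rfl
  have h2 : (Set.range fun η : F => ((η : StrongDual ℂ A) : A →ₗ[ℂ] ℂ)) =
      ContinuousLinearMap.coeLM ℂ '' F := by
    ext; simp
  rw [h2, Submodule.span_image] at h1
  obtain ⟨η, hη, he⟩ := h1
  rwa [← ContinuousLinearMap.coe_injective (he : (η : A →ₗ[ℂ] ℂ) = θ)]

section WeakIntegral

open MeasureTheory Set

variable {H : Type*} [NormedAddCommGroup H] [InnerProductSpace ℂ H] [CompleteSpace H]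

/-- The weak Laplace transform of an exponentially bounded, weakly continuous operator-valued
function. -/
theorem exists_weak_laplace {b : ℝ → H →L[ℂ] H} (hc : ∀ ξ ζ : H, Continuous fun t => ⟪ξ, b t ζ⟫_ℂ)
    {K ω : ℝ} (hK : 0 ≤ K) (hb : ∀ t, 0 ≤ t → ‖b t‖ ≤ K * Real.exp (ω * t)) {lam : ℝ}
    (hlam : ω < lam) :
    ∃ S : H →L[ℂ] H, (∀ ξ ζ, ⟪ξ, S ζ⟫_ℂ = ∫ t in Ioi (0 : ℝ), Real.exp (-lam * t) • ⟪ξ, b t ζ⟫_ℂ) ∧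
      ‖S‖ ≤ K * ∫ t in Ioi (0 : ℝ), Real.exp (-lam * t) • Real.exp (ω * t) := by
  set D : ℝ := ∫ t in Ioi (0 : ℝ), Real.exp (-lam * t) • Real.exp (ω * t) with hD
  have hD0 : 0 ≤ D := integral_nonneg fun t => by positivity
  have hDi : IntegrableOn (fun t : ℝ => Real.exp (-lam * t) • Real.exp (ω * t)) (Ioi 0) :=
    integrableOn_exp_smul (by fun_prop) (C := 1) (ω := ω)
      (fun r _ => by rw [one_mul, Real.norm_of_nonneg (Real.exp_pos _).le]) hlam
  have hbd : ∀ ξ ζ t, 0 ≤ t → ‖⟪ξ, b t ζ⟫_ℂ‖ ≤ K * ‖ξ‖ * ‖ζ‖ * Real.exp (ω * t) := fun ξ ζ t ht =>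
    calc _ ≤ ‖ξ‖ * ‖b t ζ‖ := norm_inner_le_norm _ _
      _ ≤ ‖ξ‖ * (K * Real.exp (ω * t) * ‖ζ‖) :=
        mul_le_mul_of_nonneg_left ((b t).le_of_opNorm_le (hb t ht) ζ) (norm_nonneg _)
      _ = _ := by ring
  have hi : ∀ ξ ζ, IntegrableOn (fun t : ℝ => Real.exp (-lam * t) • ⟪ξ, b t ζ⟫_ℂ) (Ioi 0) :=
    fun ξ ζ => integrableOn_exp_smul (hc ξ ζ) (hbd ξ ζ) hlam
  have hnorm : ∀ ξ ζ, ‖∫ t in Ioi (0 : ℝ), Real.exp (-lam * t) • ⟪ξ, b t ζ⟫_ℂ‖ ≤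
      K * D * ‖ξ‖ * ‖ζ‖ := fun ξ ζ => by
    have e : K * D * ‖ξ‖ * ‖ζ‖ = ∫ t in Ioi (0 : ℝ),
        Real.exp (-lam * t) • Real.exp (ω * t) * (K * ‖ξ‖ * ‖ζ‖) := by
      rw [integral_mul_const]; ring
    rw [e]
    refine norm_integral_le_of_norm_le (hDi.mul_const _) ?_
    filter_upwards [ae_restrict_mem measurableSet_Ioi] with t ht
    rw [norm_smul, Real.norm_of_nonneg (Real.exp_pos _).le, smul_eq_mul, mul_assoc]
    refine mul_le_mul_of_nonneg_left ((hbd ξ ζ t (mem_Ioi.1 ht).le).trans_eq ?_)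
      (Real.exp_pos _).le
    ring
  let B : H →ₗ⋆[ℂ] H →ₗ[ℂ] ℂ := LinearMap.mk₂'ₛₗ _ _
    (fun ξ ζ => ∫ t in Ioi (0 : ℝ), Real.exp (-lam * t) • ⟪ξ, b t ζ⟫_ℂ)
    (fun ξ₁ ξ₂ ζ => by
      simp only [inner_add_left, smul_add]
      exact integral_add (hi ξ₁ ζ) (hi ξ₂ ζ))
    (fun c ξ ζ => by
      simp only [inner_smul_left, ← smul_eq_mul (a := (starRingEnd ℂ) c), smul_comm _ (starRingEnd ℂ c)]
      exact integral_smul _ _)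
    (fun ξ ζ₁ ζ₂ => by
      simp only [map_add, inner_add_right, smul_add]
      exact integral_add (hi ξ ζ₁) (hi ξ ζ₂))
    (fun c ξ ζ => by
      simp only [map_smul, inner_smul_right, ← smul_eq_mul (a := c), smul_comm _ c]
      exact integral_smul _ _)
  let B' : H →L⋆[ℂ] H →L[ℂ] ℂ := B.mkContinuous₂ (K * D) hnorm
  refine ⟨ContinuousLinearMap.adjoint (InnerProductSpace.continuousLinearMapOfBilin B'),
    fun ξ ζ => ?_, ?_⟩
  · rw [ContinuousLinearMap.adjoint_inner_right,
      InnerProductSpace.continuousLinearMapOfBilin_apply]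
    rfl
  · rw [LinearIsometryEquiv.norm_map]
    refine ContinuousLinearMap.opNorm_le_bound _ (mul_nonneg hK hD0) fun ξ => ?_
    set v := InnerProductSpace.continuousLinearMapOfBilin B' ξ with hv
    have h1 : ‖v‖ * ‖v‖ ≤ K * D * ‖ξ‖ * ‖v‖ := by
      rw [← sq, ← inner_self_eq_norm_sq (𝕜 := ℂ) v]
      refine (RCLike.re_le_norm _).trans ?_
      rw [hv, InnerProductSpace.continuousLinearMapOfBilin_apply]
      exact hnorm ξ _
    rcases eq_or_lt_of_le (norm_nonneg v) with h0 | h0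
    · rw [← h0]; positivity
    · exact le_of_mul_le_mul_right h1 h0

end WeakIntegral

/-! ### Weak-* continuous semigroups -/

section WeakStar

open MeasureTheory Set

variable {H : Type*} [NormedAddCommGroup H] [InnerProductSpace ℂ H] [CompleteSpace H]
  {M : VonNeumannAlgebra H} {T : ℝ≥0 → M.toStarSubalgebra →L[ℂ] M.toStarSubalgebra}

theorem IsC0StarSemigroup.continuous_inner (hT : IsC0StarSemigroup M.predual T)
    (x : M.toStarSubalgebra) (ξ ζ : H) :
    Continuous fun t => ⟪ξ, (T t x : H →L[ℂ] H) ζ⟫_ℂ := by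
  obtain ⟨η, hη, hηx⟩ := M.exists_mem_predual_inner ξ ζ
  simpa only [hηx] using hT.continuous_time x η hη

/-- Weak-* continuous semigroups are exponentially bounded, by the uniform boundedness principle for
vectors of `H`, operators on `H`, and operators on the algebra. -/
theorem IsC0StarSemigroup.exists_norm_le_exp (hT : IsC0StarSemigroup M.predual T) :
    ∃ C ω : ℝ, ∀ t, ‖T t‖ ≤ C * Real.exp (ω * t) := by
  have hcl := M.isClosed_toStarSubalgebra
  have h1 : ∀ (x : M.toStarSubalgebra) (ζ : H), ∃ K, ∀ t : Icc (0 : ℝ≥0) 1,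
      ‖(T t x : H →L[ℂ] H) ζ‖ ≤ K := fun x ζ => by
    obtain ⟨K, hK⟩ := banach_steinhaus
      (g := fun t : Icc (0 : ℝ≥0) 1 => innerSL ℂ ((T t x : H →L[ℂ] H) ζ)) fun ξ => by
        obtain ⟨K, hK⟩ := (isCompact_Icc (a := (0 : ℝ≥0)) (b := 1)).bddAbove_image
          (hT.continuous_inner x ξ ζ).norm.continuousOn
        refine ⟨K, fun t => ?_⟩
        rw [innerSL_apply_apply, norm_inner_symm]
        exact hK (mem_image_of_mem _ t.2)
    exact ⟨K, fun t => by simpa only [innerSL_apply_norm] using hK t⟩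
  have h2 : ∀ x : M.toStarSubalgebra, ∃ K, ∀ t : Icc (0 : ℝ≥0) 1, ‖T t x‖ ≤ K := fun x =>
    banach_steinhaus (g := fun t : Icc (0 : ℝ≥0) 1 => (T t x : H →L[ℂ] H)) (h1 x)
  obtain ⟨K, hK⟩ := banach_steinhaus (g := fun t : Icc (0 : ℝ≥0) 1 => T t) h2
  exact hT.toIsOperatorSemigroup.exists_norm_le_exp one_pos fun t ht => hK ⟨t, ⟨zero_le, ht⟩⟩

/-- The weak Laplace transforms of a weak-* continuous semigroup exist in the algebra: they are given
by bounded sesquilinear forms on `H`, and pairing them with the predual reduces to interchanging a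
sum and an integral. -/
theorem IsC0StarSemigroup.exists_laplace (hT : IsC0StarSemigroup M.predual T) {C ω : ℝ}
    (hC : ∀ t, ‖T t‖ ≤ C * Real.exp (ω * t)) {lam : ℝ} (hlam : ω < lam) :
    ∃ R : M.toStarSubalgebra →L[ℂ] M.toStarSubalgebra, ∀ η ∈ M.predual, ∀ x,
      η (R x) = ∫ t in Ioi (0 : ℝ), Real.exp (-lam * t) • η (T t.toNNReal x) := by
  have hC0 : 0 ≤ C := by simpa using (norm_nonneg _).trans (hC 0)
  have hb : ∀ x (t : ℝ), 0 ≤ t →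
      ‖(T t.toNNReal x : H →L[ℂ] H)‖ ≤ C * ‖x‖ * Real.exp (ω * t) := fun x t ht => by
    have h1 := (T t.toNNReal).le_of_opNorm_le (hC t.toNNReal) x
    rw [Real.coe_toNNReal t ht] at h1
    refine h1.trans_eq ?_
    ring
  have hc : ∀ x (ξ ζ : H), Continuous fun t : ℝ => ⟪ξ, (T t.toNNReal x : H →L[ℂ] H) ζ⟫_ℂ :=
    fun x ξ ζ => (hT.continuous_inner x ξ ζ).comp continuous_real_toNNReal
  choose S hS hSn using fun x => exists_weak_laplace (hc x) (by positivity) (hb x) hlam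
  -- Taking the weak integral commutes with the commutant, hence stays in the algebra.
  have hSM : ∀ x, S x ∈ M.toStarSubalgebra := fun x => by
    have : S x ∈ M.commutant.commutant := by
      rw [VonNeumannAlgebra.mem_commutant_iff]
      intro y hy
      rw [VonNeumannAlgebra.mem_commutant_iff] at hy
      ext ζ
      refine ext_inner_left ℂ fun ξ => ?_
      rw [mul_apply_eq_comp, mul_apply_eq_comp, ← ContinuousLinearMap.adjoint_inner_left, hS, hS]
      refine integral_congr_ae (Eventually.of_forall fun t => ?_)
      have h1 := congrArg (fun V : H →L[ℂ] H => V ζ) (hy _ (T t.toNNReal x).2)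
      simp only [mul_apply_eq_comp] at h1
      simp only [ContinuousLinearMap.adjoint_inner_left, h1]
    rwa [M.commutant_commutant] at this
  have hi : ∀ x (ξ ζ : H), IntegrableOn (fun t : ℝ => Real.exp (-lam * t) •
      ⟪ξ, (T t.toNNReal x : H →L[ℂ] H) ζ⟫_ℂ) (Ioi 0) := fun x ξ ζ => by
    refine integrableOn_exp_smul (hc x ξ ζ) (C := ‖ξ‖ * (C * ‖x‖) * ‖ζ‖) (ω := ω)
      (fun t ht => ?_) hlam
    calc _ ≤ ‖ξ‖ * ‖(T t.toNNReal x : H →L[ℂ] H) ζ‖ := norm_inner_le_norm _ _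
      _ ≤ ‖ξ‖ * (C * ‖x‖ * Real.exp (ω * t) * ‖ζ‖) := mul_le_mul_of_nonneg_left
        ((T t.toNNReal x : H →L[ℂ] H).le_of_opNorm_le (hb x t ht) ζ) (norm_nonneg _)
      _ = _ := by ring
  let R₀ : M.toStarSubalgebra →ₗ[ℂ] M.toStarSubalgebra :=
    { toFun := fun x => ⟨S x, hSM x⟩
      map_add' := fun x y => Subtype.ext <| by
        ext ζ
        refine ext_inner_left ℂ fun ξ => ?_
        change ⟪ξ, S (x + y) ζ⟫_ℂ = ⟪ξ, S x ζ + S y ζ⟫_ℂ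
        rw [inner_add_right, hS, hS, hS, ← integral_add (hi x ξ ζ) (hi y ξ ζ)]
        refine integral_congr_ae (Eventually.of_forall fun t => ?_)
        simp
      map_smul' := fun c x => Subtype.ext <| by
        ext ζ
        refine ext_inner_left ℂ fun ξ => ?_
        change ⟪ξ, S (c • x) ζ⟫_ℂ = ⟪ξ, c • S x ζ⟫_ℂ
        rw [inner_smul_right, hS, hS, ← smul_eq_mul, ← integral_smul]
        refine integral_congr_ae (Eventually.of_forall fun t => ?_)
        simp [mul_left_comm] }
  refine ⟨R₀.mkContinuous (C * ∫ t in Ioi (0 : ℝ), Real.exp (-lam * t) • Real.exp (ω * t))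
    fun x => (hSn x).trans_eq (by ring), ?_⟩
  rintro η ⟨ξ, ζ, hξ, hζ, hsum⟩ x
  have hF : ∀ t : ℝ, Real.exp (-lam * t) • η (T t.toNNReal x) = ∑' n, Real.exp (-lam * t) •
      ⟪ξ n, (T t.toNNReal x : H →L[ℂ] H) (ζ n)⟫_ℂ := fun t =>
    ((hsum (T t.toNNReal x)).const_smul (Real.exp (-lam * t))).tsum_eq.symm
  have hDi : IntegrableOn (fun t : ℝ => Real.exp (-lam * t) • Real.exp (ω * t)) (Ioi 0) :=
    integrableOn_exp_smul (by fun_prop) (C := 1) (ω := ω)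
      (fun r _ => by rw [one_mul, Real.norm_of_nonneg (Real.exp_pos _).le]) hlam
  have hsummable : Summable fun n => ∫ t in Ioi (0 : ℝ), ‖Real.exp (-lam * t) •
      ⟪ξ n, (T t.toNNReal x : H →L[ℂ] H) (ζ n)⟫_ℂ‖ := by
    refine .of_nonneg_of_le (fun n => integral_nonneg fun t => norm_nonneg _) (fun n => ?_)
      ((VonNeumannAlgebra.summable_norm_mul_norm hξ hζ).mul_left
        ((∫ t in Ioi (0 : ℝ), Real.exp (-lam * t) • Real.exp (ω * t)) * (C * ‖x‖)))
    rw [mul_assoc, ← integral_mul_const]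
    refine setIntegral_mono_on (hi x _ _).norm (hDi.mul_const _) measurableSet_Ioi fun t ht => ?_
    rw [norm_smul, Real.norm_of_nonneg (Real.exp_pos _).le, smul_eq_mul, mul_assoc]
    refine mul_le_mul_of_nonneg_left ?_ (Real.exp_pos _).le
    calc _ ≤ ‖ξ n‖ * ‖(T t.toNNReal x : H →L[ℂ] H) (ζ n)‖ := norm_inner_le_norm _ _
      _ ≤ ‖ξ n‖ * (C * ‖x‖ * Real.exp (ω * t) * ‖ζ n‖) := mul_le_mul_of_nonneg_left
        ((T t.toNNReal x : H →L[ℂ] H).le_of_opNorm_le (hb x t (mem_Ioi.1 ht).le) _) (norm_nonneg _)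
      _ = _ := by ring
  have h1 := hasSum_integral_of_summable_integral_norm (fun n => hi x (ξ n) (ζ n)) hsummable
  simp only [← hF, ← hS] at h1
  exact (hsum ⟨S x, hSM x⟩).unique h1

end WeakStar

/-! ### The equivalence -/

theorem theorem1 :
    -- strongly continuous semigroups on a unital C*-algebra
    (∀ {A : Type*} [CStarAlgebra A] [PartialOrder A] [StarOrderedRing A]
        (T : ℝ≥0 → A →L[ℂ] A) (L : A →ₗ.[ℂ] A),
      IsC0Semigroup T → (∀ t, IsSymmetricMap (T t)) → IsGenerator Set.univ T L →
        (∀ᶠ lam : ℝ in atTop, ∃ R, IsResolvent L lam R) ∧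
        List.TFAE [
          ∀ t, IsPositiveMap (T t),
          ∀ᶠ lam : ℝ in atTop, ∃ R, IsResolvent L lam R ∧ IsPositiveMap R,
          ∀ᶠ lam : ℝ in atTop, ∃ R, IsResolvent L lam R ∧ SelfAdjointInequality R,
          ∀ᶠ lam : ℝ in atTop, ∃ R, IsResolvent L lam R ∧ UnitaryInequality R,
          ∀ t, SelfAdjointInequality (T t),
          ∀ t, UnitaryInequality (T t)]) ∧
    -- weak-* continuous semigroups on a von Neumann algebra
    (∀ {H : Type*} [NormedAddCommGroup H] [InnerProductSpace ℂ H] [CompleteSpace H]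
        (M : VonNeumannAlgebra H)
        (T : ℝ≥0 → M.toStarSubalgebra →L[ℂ] M.toStarSubalgebra)
        (L : M.toStarSubalgebra →ₗ.[ℂ] M.toStarSubalgebra),
      IsC0StarSemigroup M.predual T → (∀ t, IsSymmetricMap (T t)) →
      IsGenerator M.predual T L →
        (∀ᶠ lam : ℝ in atTop, ∃ R, IsResolvent L lam R) ∧
        List.TFAE [
          ∀ t, IsPositiveMap (T t),
          ∀ᶠ lam : ℝ in atTop, ∃ R, IsResolvent L lam R ∧ IsPositiveMap R,
          ∀ᶠ lam : ℝ in atTop, ∃ R, IsResolvent L lam R ∧ SelfAdjointInequality R,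
          ∀ᶠ lam : ℝ in atTop, ∃ R, IsResolvent L lam R ∧ UnitaryInequality R,
          ∀ t, SelfAdjointInequality (T t),
          ∀ t, UnitaryInequality (T t)]) := by
  refine ⟨fun {A} _ _ _ T L hT hs hL => ?_, fun {H} _ _ _ M T L hT hs hL => ?_⟩
  · obtain ⟨C, ω, h⟩ := hT.isWeakSemigroup
    exact h.tfae hs hL
  · have hcl := M.isClosed_toStarSubalgebra
    have hso := M.starOrderedRing
    obtain ⟨C, ω, hC⟩ := hT.exists_norm_le_exp
    have h : IsWeakSemigroup M.predual T C ω :=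
      { toIsOperatorSemigroup := hT.toIsOperatorSemigroup
        norm_le := hC
        continuous_time := fun η hη x => hT.continuous_time x η hη
        comp_mem_span := fun η hη t =>
          mem_span_of_continuous_sigmaTopology (hT.continuous_space η hη t)
        exists_mul := fun η hη => VonNeumannAlgebra.exists_mul_mem_predual hη
        exists_star := fun η hη => VonNeumannAlgebra.exists_star_mem_predual hη
        nonneg := fun x hx => VonNeumannAlgebra.nonneg_of_forall_predual hx
        exists_laplace := fun lam hlam => hT.exists_laplace hC hlam }
    exact h.tfae hs hL
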